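/- Let $X=G/P$ be a minuscule or cominuscule homogeneous space, where $G$ is a simple complex algebraic group and $P$ is the maximal parabolic subgroup attached to a simple root $\beta$. Let $W$ be the Weyl group of $G$, let $W_P\subset W$ be the subgroup generated by the simple reflections other than $s_\beta$, and let $w_0$, $w_0^P$ be the longest elements of $W$, $W_P$. On $W_X=W/W_P$ consider the permutations $p(w)=w_0w$ (Poincaré duality) and $\iota(w)=w_0^Pw$. Let $\eta$ be the order of the permutation $p\iota$ of $W_X$, and let $\Gamma$ be the group of permutations of $W_X^3$ generated by $(p,p,\iota)$, $(p,\iota,p)$ and $(\iota,p,p)$. (1) If $X\neq\mathbb P^1$, that is, if $G$ has rank at least $2$, then $\Gamma$ has order $2\eta^2$. (2) The values of $\eta$ for the following spaces, each taken with the indicated type of $(G,P)$ in Bourbaki's numbering, are: - $\eta=n/\gcd(p,n-p)$ for the Grassmannian $\mathbb G(p,n)=A_{n-1}/P_p$, $0<p<n$; - $\eta=2$ for the Lagrangian Grassmannian $\mathbb G_\omega(n,2n)=C_n/P_n$, $n\ge 1$; - $\eta=4/\gcd(2,n)$ for the orthogonal Grassmannian $\mathbb G_Q(n,2n)=D_n/P_n$,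 $n\ge 2$ (one family of maximal isotropic subspaces; $D_3=A_3$, and for $n=2$ the same definitions are used with the non-simple type $D_2=A_1\times A_1$); - $\eta=3$ for the Cayley plane $\mathbb{OP}^2=E_6/P_1$; - $\eta=2$ for the Freudenthal variety $E_7/P_7$. -/

import Mathlib

namespace HiddenSymmetry

variable {J K M N : Type*} [Field K] [AddCommGroup M] [Module K M]
  [AddCommGroup N] [Module K N] {P : RootPairing J K M N}

/-- The simple reflection `s_i` attached to a simple root, as an element of the Weyl group. -/
noncomputable def simpleReflection (b : P.Base) (i : b.support) : P.weylGroup :=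
  RootPairing.weylGroup.ofIdx P i

/-- The length `ℓ(w)`: the least number of factors in an expression of `w` as a product of
simple reflections. -/
noncomputable def length (b : P.Base) (w : P.weylGroup) : ℕ :=
  sInf {n | ∃ l : List b.support, l.length = n ∧ (l.map (simpleReflection b)).prod = w}

/-- The Weyl group `W_P` of the maximal parabolic subgroup defined by the simple root `β`:
it is generated by all simple reflections except `s_β`. -/
noncomputable def parabolic (b : P.Base) (β : b.support) : Subgroup P.weylGroup :=
  Subgroup.closure (simpleReflection b '' {i | i ≠ β})

/-- `w` is an element of maximal length of the subgroup `H` of the Weyl group. -/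
def IsLongest (b : P.Base) (H : Subgroup P.weylGroup) (w : P.weylGroup) : Prop :=
  w ∈ H ∧ ∀ v ∈ H, length b v ≤ length b w

/-- The Weyl group of a finite root system is finite. -/
theorem finite_weylGroup [Finite J] [P.IsRootSystem] : Finite P.weylGroup := by
  refine Finite.of_injective (fun w : P.weylGroup => (P.weylGroupToPerm w : J ≃ J)) ?_
  intro g h hgh
  have key : ∀ m : M, g • m = h • m := by
    intro m
    have hm : m ∈ P.rootSpan K := by simp
    induction hm using Submodule.span_induction with
    | mem x hx =>
      obtain ⟨i, rfl⟩ := hx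
      rw [P.weylGroup_apply_root, P.weylGroup_apply_root]
      exact congrArg P.root (congrArg (fun e : J ≃ J => e i) hgh)
    | zero => simp
    | add x y _ _ hx hy => rw [smul_add, smul_add, hx, hy]
    | smul a x _ hx => rw [smul_comm g a x, smul_comm h a x, hx]
  apply Subtype.ext
  apply RootPairing.Equiv.weightHom_injective P
  ext m
  exact key m

theorem exists_isLongest [Finite J] [P.IsRootSystem] (b : P.Base)
    (H : Subgroup P.weylGroup) : ∃ w, IsLongest b H w := by
  have := finite_weylGroup (P := P)
  obtain ⟨w, hw⟩ := Finite.exists_max (fun v : H => length b (v : P.weylGroup))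
  exact ⟨w, w.2, fun v hv => hw ⟨v, hv⟩⟩

/-- The longest element of `H`; it is unique when `H` is the Weyl group or a standard parabolic
subgroup of it. -/
noncomputable def longest [Finite J] [P.IsRootSystem] (b : P.Base)
    (H : Subgroup P.weylGroup) : P.weylGroup :=
  (exists_isLongest b H).choose

/-- The set `W_X ≃ W / W_P` indexing the Schubert classes of `X = G / P`. -/
abbrev SchubertIndex (b : P.Base) (β : b.support) : Type _ :=
  P.weylGroup ⧸ parabolic b β

section Involutions

variable [Finite J] [P.IsRootSystem]

/-- Poincaré duality `p : w ↦ w₀ w` on `W / W_P`. -/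
noncomputable def poincareDuality (b : P.Base) (β : b.support) :
    Equiv.Perm (SchubertIndex b β) :=
  MulAction.toPerm (longest b ⊤)

/-- The involution `ι : w ↦ w₀ᴾ w` on `W / W_P`, where `w₀ᴾ` is the longest element of `W_P`. -/
noncomputable def strangeDuality (b : P.Base) (β : b.support) :
    Equiv.Perm (SchubertIndex b β) :=
  MulAction.toPerm (longest b (parabolic b β))

/-- The order `η` of the permutation `p ι`. -/
noncomputable def eta (b : P.Base) (β : b.support) : ℕ :=
  orderOf (poincareDuality b β * strangeDuality b β)

/-- The group `Γ` of permutations of `W_X³` generated by `(p,p,ι)`, `(p,ι,p)`, `(ι,p,p)`. -/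
noncomputable def symmetryGroup (b : P.Base) (β : b.support) :
    Subgroup (Equiv.Perm (SchubertIndex b β × SchubertIndex b β × SchubertIndex b β)) :=
  let p := poincareDuality b β
  let i := strangeDuality b β
  Subgroup.closure
    {Equiv.prodCongr p (Equiv.prodCongr p i),
     Equiv.prodCongr p (Equiv.prodCongr i p),
     Equiv.prodCongr i (Equiv.prodCongr p p)}

end Involutions

/-- `β` (equivalently `G / P`) is cominuscule: it has coefficient `-1`, `0` or `1` in every root
(that is, coefficient one in the highest root). -/
def IsCominuscule [P.IsRootSystem] (b : P.Base) (β : b.support) : Prop :=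
  ∀ j : J, b.toWeightBasis.repr (P.root j) β ∈ ({-1, 0, 1} : Set K)

/-- `β` (equivalently `G / P`) is minuscule: the fundamental weight dual to the simple coroot
`β^∨` takes only the values `-1`, `0`, `1` on coroots. -/
def IsMinuscule [P.IsRootSystem] (b : P.Base) (β : b.support) : Prop :=
  ∀ j : J, b.toCoweightBasis.repr (P.coroot j) β ∈ ({-1, 0, 1} : Set K)

/-- The pair `(b, β)` has the Dynkin type of the pair `(A, k)`: after a numbering of the simple
roots, the Cartan matrix `⟨α_i, α_j^∨⟩` is `A` and `β` is the simple root number `k`. -/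
def HasType [CharZero K] [P.IsCrystallographic] (b : P.Base) (β : b.support)
    {n : ℕ} (A : Matrix (Fin n) (Fin n) ℤ) (k : Fin n) : Prop :=
  ∃ e : b.support ≃ Fin n, (∀ i j, b.cartanMatrix i j = A (e i) (e j)) ∧ e β = k

end HiddenSymmetry

/-!
The group `Γ` is computed in `card_closure_triples`: with `r = p ι`, it consists of the triples
`(rᵐ, rⁿ, r⁻ᵐ⁻ⁿ)` and of their products with `(p, p, ι)`.  Its order is `2 η²` as soon as `ι ≠ 1`,
and `ι` moves the coset of `s_β` when some simple root is joined to `β` (`strangeDuality_ne_one`).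

The order `η` is read off from the Weyl group element `w₀ w₀ᴾ`, called `rotation` here: a power of
it that is trivial gives an upper bound, and a power of `p ι` that is trivial comes from a power of
`w₀ w₀ᴾ` that lies in `W_P`, hence preserves the coefficient at `β`.  If `β` is cominuscule, then
`w₀ w₀ᴾ` permutes the simple roots and the lowest root `-θ`, where `θ = w₀ᴾ β` is the highest root:
it is an automorphism of the extended Dynkin diagram.  To find it, one needs `θ` and the opposition
involutions `-w₀` and `-w₀ᴾ` of the simple roots.

That the longest element of a standard subgroup maps its simple roots to negatives of simple roots
(`IsLongest.exists_smul_root_eq_neg`) follows from the exchange property.  Which simple roots these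
are is decided by two facts: `-w` preserves the Cartan matrix, and `w` acts trivially on the
weights modulo the root lattice (`exists_smul_eq_add_smul_sum`), so that suitable weights give
congruences for the involution.  The root `θ` follows from the fact that `w₀ᴾ` fixes the fundamental
weight at `β` (`NumberedOpposition.parabolic_smul_root_self`).

If `-w₀` fixes `β`, then `η = 2` without further computation (`eta_eq_two_of_longest_smul_root`);
this covers the types `C` and `E₇` and the type `D` of even rank.
-/

set_option linter.unusedSectionVars false

namespace HiddenSymmetry

open Finset

variable {J K M N : Type*} [Field K] [AddCommGroup M] [Module K M]
  [AddCommGroup N] [Module K N] {P : RootPairing J K M N}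

/-! ### Words in the simple reflections -/

theorem weylGroup_ext [P.IsRootSystem] {g h : P.weylGroup}
    (key : ∀ m : M, g • m = h • m) : g = h := by
  apply Subtype.ext
  apply RootPairing.Equiv.weightHom_injective P
  ext m
  exact key m

theorem weylGroup_ext_base [P.IsRootSystem] (b : P.Base) {g h : P.weylGroup}
    (key : ∀ i : b.support, g • P.root i = h • P.root i) : g = h := by
  apply weylGroup_ext
  have := b.toWeightBasis.ext (f₁ := DistribSMul.toLinearMap K M g)
    (f₂ := DistribSMul.toLinearMap K M h) (fun i => by simpa using key i)
  exact fun m => congrArg (fun f => f m) this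

/-- The coefficient of the simple root `i`, as a linear functional on the weight space. -/
noncomputable def coord [P.IsRootSystem] (b : P.Base) (i : b.support) : M →ₗ[K] K :=
  b.toWeightBasis.coord i

theorem coord_root [P.IsRootSystem] (b : P.Base) [DecidableEq b.support] (i j : b.support) :
    coord b i (P.root j) = if j = i then 1 else 0 := by
  simp [coord, Finsupp.single_apply]

theorem simpleReflection_smul (b : P.Base) (i : b.support) (x : M) :
    simpleReflection b i • x = x - P.coroot' i x • P.root i := by
  rw [← RootPairing.reflection_apply]; rfl

theorem simpleReflection_mul_self [P.IsRootSystem] (b : P.Base) (i : b.support) :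
    simpleReflection b i * simpleReflection b i = 1 :=
  weylGroup_ext fun m => by
    rw [mul_smul, one_smul]; exact P.reflection_same i m

theorem simpleReflection_inv [P.IsRootSystem] (b : P.Base) (i : b.support) :
    (simpleReflection b i)⁻¹ = simpleReflection b i :=
  inv_eq_of_mul_eq_one_left (simpleReflection_mul_self b i)

theorem weylGroupToPerm_simpleReflection (b : P.Base) (i : b.support) (j : J) :
    P.weylGroupToPerm (simpleReflection b i) j = P.reflectionPerm i j := by
  apply P.root.injective
  rw [← P.weylGroup_apply_root, P.root_reflectionPerm]; rfl

theorem coroot'_weylGroup_smul (w : P.weylGroup) (i : J) (x : M) :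
    P.coroot' (P.weylGroupToPerm w i) (w • x) = P.coroot' i x := by
  obtain ⟨w, hw⟩ := w
  induction hw using RootPairing.weylGroup.induction generalizing i x with
  | mem k =>
    change P.coroot' (P.reflectionPerm k i) (P.reflection k x) = _
    rw [P.coroot'_reflection, P.reflectionPerm_self]
  | one => rfl
  | mul g₁ g₂ h₁ h₂ ih₁ ih₂ => exact (ih₁ _ _).trans (ih₂ _ _)

theorem simpleReflection_conj [P.IsRootSystem] (b : P.Base) (w : P.weylGroup) {i j : b.support}
    (h : P.weylGroupToPerm w i = j) :
    simpleReflection b j * w = w * simpleReflection b i := by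
  refine weylGroup_ext fun m => ?_
  rw [mul_smul, mul_smul, simpleReflection_smul, simpleReflection_smul, smul_sub,
    smul_comm w, P.weylGroup_apply_root, h, ← coroot'_weylGroup_smul w i, h]

theorem eq_reflectionPerm_of_root_eq_neg {j k : J} (h : P.root k = -P.root j) :
    k = P.reflectionPerm j j := by
  apply P.root.injective
  rw [h, P.root_reflectionPerm, P.reflection_apply_self]

theorem height_of_root_eq_neg [CharZero K] (b : P.Base) {j k : J} (h : P.root k = -P.root j) :
    b.height k = -b.height j := by
  rw [eq_reflectionPerm_of_root_eq_neg h]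
  exact b.height_reflectionPerm_self j

/-- The standard subgroup of the Weyl group generated by a set of simple reflections. -/
noncomputable def standardSubgroup (b : P.Base) (I : Set b.support) : Subgroup P.weylGroup :=
  Subgroup.closure (simpleReflection b '' I)

theorem simpleReflection_mem (b : P.Base) {I : Set b.support} {i : b.support} (hi : i ∈ I) :
    simpleReflection b i ∈ standardSubgroup b I :=
  Subgroup.subset_closure ⟨i, hi, rfl⟩

section

variable [P.IsRootSystem]

theorem exists_word_of_mem (b : P.Base) {I : Set b.support} {w : P.weylGroup}
    (hw : w ∈ standardSubgroup b I) :
    ∃ l : List b.support, (l.map (simpleReflection b)).prod = w := by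
  induction hw using Subgroup.closure_induction with
  | mem x hx => obtain ⟨i, -, rfl⟩ := hx; exact ⟨[i], by simp⟩
  | one => exact ⟨[], rfl⟩
  | mul x y _ _ hx hy =>
    obtain ⟨l, rfl⟩ := hx
    obtain ⟨l', rfl⟩ := hy
    exact ⟨l ++ l', by simp⟩
  | inv x _ hx =>
    obtain ⟨l, rfl⟩ := hx
    exact ⟨l.reverse, by simp [List.prod_inv_reverse, Function.comp_def, simpleReflection_inv]⟩

end

theorem length_prod_le (b : P.Base) (l : List b.support) :
    length b (l.map (simpleReflection b)).prod ≤ l.length :=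
  Nat.sInf_le ⟨l, rfl, rfl⟩

section Finite

variable [P.IsRootSystem] [Finite J] [CharZero K] [P.IsCrystallographic] [P.IsReduced] (b : P.Base)

theorem standardSubgroup_univ : standardSubgroup b Set.univ = ⊤ := by
  have key (j : J) : RootPairing.weylGroup.ofIdx P j ∈ standardSubgroup b Set.univ := by
    refine b.induction_reflect j
      (p := fun j => RootPairing.weylGroup.ofIdx P j ∈ standardSubgroup b Set.univ) ?_ ?_ ?_
    · intro i hi
      convert hi using 1
      refine weylGroup_ext fun m => ?_
      change P.reflection _ m = P.reflection _ m
      rw [P.reflection_reflectionPerm]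
      simp
    · exact fun i hi => simpleReflection_mem b (i := ⟨i, hi⟩) (Set.mem_univ _)
    · intro i k hi hk
      have hs := simpleReflection_mem b (i := ⟨k, hk⟩) (Set.mem_univ _)
      convert mul_mem (mul_mem hs hi) hs using 1
      refine weylGroup_ext fun m => ?_
      change P.reflection _ m = P.reflection _ (P.reflection _ (P.reflection _ m))
      rw [P.reflection_reflectionPerm]
      rfl
  rw [eq_top_iff]
  rintro ⟨w, hw⟩ -
  induction hw using RootPairing.weylGroup.induction with
  | mem i => exact key i
  | one => exact one_mem _
  | mul x y hx hy hx' hy' => exact mul_mem hx' hy'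

theorem exists_reduced_word (w : P.weylGroup) :
    ∃ l : List b.support, l.length = length b w ∧ (l.map (simpleReflection b)).prod = w := by
  obtain ⟨l, hl⟩ := exists_word_of_mem b (I := Set.univ) (w := w)
    (by rw [standardSubgroup_univ]; exact Subgroup.mem_top w)
  exact Nat.sInf_mem (s := {n | ∃ l : List b.support, l.length = n ∧
    (l.map (simpleReflection b)).prod = w}) ⟨_, l, rfl, hl⟩

/-- The exchange property: if `w αᵢ` is negative, then a letter can be deleted from any word for `w`
so that the remaining letters give `w sᵢ`. -/
theorem exists_exchange (i : b.support) (l : List b.support)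
    (h : ¬ b.IsPos (P.weylGroupToPerm (l.map (simpleReflection b)).prod i)) :
    ∃ l' : List b.support, l'.length + 1 = l.length ∧
      (l'.map (simpleReflection b)).prod =
        (l.map (simpleReflection b)).prod * simpleReflection b i := by
  induction l with
  | nil => exact absurd (b.isPos_of_mem_support i.2) (by simpa using h)
  | cons j l ih =>
    by_cases hl : b.IsPos (P.weylGroupToPerm (l.map (simpleReflection b)).prod i)
    · refine ⟨l, rfl, ?_⟩
      have hj : P.weylGroupToPerm (l.map (simpleReflection b)).prod i = j := by
        by_contra hne
        apply h
        rw [List.map_cons, List.prod_cons, map_mul, Equiv.Perm.mul_apply,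
          weylGroupToPerm_simpleReflection]
        exact hl.reflectionPerm j.2 hne
      rw [List.map_cons, List.prod_cons, mul_assoc, ← simpleReflection_conj b _ hj, ← mul_assoc,
        simpleReflection_mul_self, one_mul]
    · obtain ⟨l', h₁, h₂⟩ := ih hl
      exact ⟨j :: l', by simp [h₁], by simp [h₂, mul_assoc]⟩

/-- If `w αᵢ` is positive, then `w sᵢ αᵢ` is negative, and exchange shortens a reduced word
for `w sᵢ` to a word for `w`. -/
theorem length_lt_of_isPos {w : P.weylGroup} {i : b.support}
    (h : b.IsPos (P.weylGroupToPerm w i)) : length b w < length b (w * simpleReflection b i) := by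
  obtain ⟨l, hl, hw⟩ := exists_reduced_word b (w * simpleReflection b i)
  have hneg : ¬ b.IsPos (P.weylGroupToPerm (w * simpleReflection b i) i) := by
    have hk : P.root (P.weylGroupToPerm (w * simpleReflection b i) i) =
        -P.root (P.weylGroupToPerm w i) := by
      rw [← P.weylGroup_apply_root, ← P.weylGroup_apply_root, mul_smul, ← smul_neg]
      exact congrArg _ (P.reflection_apply_self i)
    rw [RootPairing.Base.isPos_iff] at h ⊢
    rw [height_of_root_eq_neg b hk]
    omega
  rw [← hw] at hneg
  obtain ⟨l', h₁, h₂⟩ := exists_exchange b i l hneg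
  rw [hw, mul_assoc, simpleReflection_mul_self, mul_one] at h₂
  have := length_prod_le b l'
  rw [h₂] at this
  omega

/-- An element of the Weyl group that keeps every simple root positive is trivial. -/
theorem eq_one_of_forall_isPos {w : P.weylGroup}
    (h : ∀ i : b.support, b.IsPos (P.weylGroupToPerm w i)) : w = 1 := by
  obtain ⟨l, hl, hw⟩ := exists_reduced_word b w
  rcases List.eq_nil_or_concat' l with rfl | ⟨l', i, rfl⟩
  · simpa using hw.symm
  · have h₁ := length_lt_of_isPos b (h i)
    have h₂ := length_prod_le b l'
    have h₃ : (l'.map (simpleReflection b)).prod = w * simpleReflection b i := by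
      simp [← hw, mul_assoc, simpleReflection_mul_self]
    rw [h₃] at h₂
    simp at hl
    omega

theorem length_inv_le (w : P.weylGroup) : length b w⁻¹ ≤ length b w := by
  obtain ⟨l, hl, hw⟩ := exists_reduced_word b w
  have := length_prod_le b l.reverse
  have e : (l.reverse.map (simpleReflection b)).prod = w⁻¹ := by
    simp [← hw, List.prod_inv_reverse, Function.comp_def, simpleReflection_inv]
  rw [e] at this
  simpa [hl] using this

theorem IsLongest.inv {b : P.Base} {H : Subgroup P.weylGroup} {w : P.weylGroup}
    (h : IsLongest b H w) : IsLongest b H w⁻¹ := by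
  refine ⟨inv_mem h.1, fun v hv => (h.2 v hv).trans ?_⟩
  simpa using length_inv_le b w⁻¹

theorem IsLongest.not_isPos {b : P.Base} {H : Subgroup P.weylGroup} {w : P.weylGroup}
    (h : IsLongest b H w) {i : b.support} (hi : simpleReflection b i ∈ H) :
    ¬ b.IsPos (P.weylGroupToPerm w i) := fun hp =>
  (h.2 _ (mul_mem h.1 hi)).not_gt (length_lt_of_isPos b hp)

end Finite

/-! ### The opposition involution of a standard subgroup -/

section

/-- The generators of a standard subgroup change a vector only by multiples of their own simple
roots. -/
theorem coord_smul_of_mem [P.IsRootSystem] (b : P.Base) {I : Set b.support} {w : P.weylGroup}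
    (hw : w ∈ standardSubgroup b I) {i : b.support} (hi : i ∉ I) (x : M) :
    coord b i (w • x) = coord b i x := by
  classical
  induction hw using Subgroup.closure_induction generalizing x with
  | mem _ h =>
    obtain ⟨j, hj, rfl⟩ := h
    have hji : j ≠ i := fun h => hi (h ▸ hj)
    rw [simpleReflection_smul, map_sub, map_smul, coord_root, if_neg hji, smul_zero, sub_zero]
  | one => rw [one_smul]
  | mul g h _ _ hg hh => rw [mul_smul, hg, hh]
  | inv g _ hg => rw [← hg (g⁻¹ • x), smul_inv_smul]

theorem root_eq_sum_coeff [CharZero K] (b : P.Base) (j : J) :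
    ∃ f : b.support → ℤ, P.root j = ∑ i, f i • P.root i ∧ b.height j = ∑ i, f i ∧
      (b.IsPos j → ∀ i, 0 ≤ f i) ∧ (¬ b.IsPos j → ∀ i, f i ≤ 0) := by
  obtain ⟨f, -, hf, hj⟩ := b.exists_root_eq_sum_int j
  have hh := RootPairing.Base.height_eq_sum hj
  refine ⟨fun i => f i, ?_, ?_, fun hp i => ?_, fun hp i => ?_⟩
  · rw [hj, ← Finset.sum_coe_sort]
  · rw [hh, ← Finset.sum_coe_sort]
  · refine (hf.resolve_right fun hn => ?_).le i
    rw [b.isPos_iff, hh] at hp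
    exact hp.not_ge (Finset.sum_nonpos fun i _ => hn.le i)
  · refine (hf.resolve_left fun hn => hp ?_).le i
    rw [b.isPos_iff', hh]
    exact Finset.sum_nonneg fun i _ => hn.le i

theorem coroot'_sum [P.IsCrystallographic] (b : P.Base) (y : b.support → ℤ) (j : b.support) :
    P.coroot' j (∑ i, y i • P.root i) = ((∑ i, y i * b.cartanMatrix i j : ℤ) : K) := by
  have h (i : b.support) : P.pairing i j = ((b.cartanMatrix i j : ℤ) : K) :=
    (b.algebraMap_cartanMatrixIn_apply ℤ i j).symm
  simp only [map_sum, map_zsmul, P.root_coroot'_eq_pairing, h]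
  simp

theorem coord_sum [P.IsRootSystem] (b : P.Base) (f : b.support → ℤ) (i : b.support) :
    coord b i (∑ j, f j • P.root j) = f i := by
  classical
  simp [coord_root]

/-- A standard subgroup acts trivially on the weights modulo the root lattice.  The vector
`y / d` has integral pairings with the simple coroots indexed by `I`, so it is a weight of the
corresponding Levi subgroup. -/
theorem exists_smul_eq_add_smul_sum [P.IsRootSystem] [P.IsCrystallographic] (b : P.Base)
    {I : Set b.support} {w : P.weylGroup}
    (hw : w ∈ standardSubgroup b I) {d : ℤ} {y : b.support → ℤ}
    (hy : ∀ j ∈ I, d ∣ ∑ i, y i * b.cartanMatrix i j) :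
    ∃ z : b.support → ℤ, w • ∑ i, y i • P.root i = ∑ i, (y i + d * z i) • P.root i := by
  classical
  have simple (j : b.support) (hj : j ∈ I) (y : b.support → ℤ)
      (hy : ∀ j ∈ I, d ∣ ∑ i, y i * b.cartanMatrix i j) :
      ∃ z : b.support → ℤ, simpleReflection b j • ∑ i, y i • P.root i =
        ∑ i, (y i + d * z i) • P.root i := by
    obtain ⟨c, hc⟩ := hy j hj
    refine ⟨fun i => if i = j then -c else 0, ?_⟩
    rw [simpleReflection_smul, coroot'_sum, hc, Int.cast_smul_eq_zsmul]
    simp only [add_smul, Finset.sum_add_distrib]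
    rw [Finset.sum_eq_single (f := fun i : b.support => (d * if i = j then -c else 0) • P.root i) j]
    · simp [sub_eq_add_neg]
    · intro i _ hi; simp [hi]
    · simp
  induction hw using Subgroup.closure_induction'' generalizing y with
  | mem _ h =>
    obtain ⟨j, hj, rfl⟩ := h
    exact simple j hj y hy
  | inv_mem _ h =>
    obtain ⟨j, hj, rfl⟩ := h
    rw [simpleReflection_inv]
    exact simple j hj y hy
  | one => exact ⟨0, by simp⟩
  | mul g h _ _ hg hh =>
    obtain ⟨z, hz⟩ := hh hy
    obtain ⟨z', hz'⟩ := hg (y := fun i => y i + d * z i) (fun j hj => by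
      simp only [add_mul, Finset.sum_add_distrib, mul_assoc, ← Finset.mul_sum]
      exact dvd_add (hy j hj) (dvd_mul_right _ _))
    refine ⟨z + z', ?_⟩
    rw [mul_smul, hz, hz']
    simp [mul_add, add_assoc]

variable [P.IsRootSystem] [CharZero K] (b : P.Base)

theorem isPos_of_coord_eq_one {j : J} {i : b.support} (h : coord b i (P.root j) = 1) :
    b.IsPos j := by
  obtain ⟨f, hf, -, -, hneg⟩ := root_eq_sum_coeff b j
  by_contra hp
  rw [hf, coord_sum] at h
  have := hneg hp i
  have h' : f i = 1 := by exact_mod_cast h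
  omega

variable [Finite J] [P.IsCrystallographic] [P.IsReduced]

/-- The longest element of a standard subgroup maps its simple roots to negatives of its simple
roots: it and its inverse are negative on these simple roots, and the height of a simple root
is `1`. -/
theorem IsLongest.exists_smul_root_eq_neg {b : P.Base} {I : Set b.support} {w : P.weylGroup}
    (hw : IsLongest b (standardSubgroup b I) w) {i : b.support} (hi : i ∈ I) :
    ∃ j ∈ I, w • P.root i = -P.root j := by
  classical
  obtain ⟨f, hf, -, -, hneg⟩ := root_eq_sum_coeff b (P.weylGroupToPerm w i)
  replace hneg := hneg (hw.not_isPos (simpleReflection_mem b hi))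
  have hfI (j : b.support) (hj : j ∉ I) : f j = 0 := by
    have hij : (i : b.support) ≠ j := fun h => hj (h ▸ hi)
    have := coord_smul_of_mem b hw.1 hj (P.root i)
    rw [P.weylGroup_apply_root, hf, coord_sum, coord_root, if_neg hij] at this
    exact_mod_cast this
  -- the height of a simple root is `1`, and `w⁻¹` is negative on every simple root in `I`
  choose g hg hg' _ _ using fun j : J => root_eq_sum_coeff b j
  have hsum : ∑ j, f j * b.height (P.weylGroupToPerm w⁻¹ j) = 1 := by
    have h₁ : P.root i = ∑ k : b.support,
        (∑ j, f j * g (P.weylGroupToPerm w⁻¹ j) k) • P.root k := by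
      calc P.root i = w⁻¹ • w • P.root i := (inv_smul_smul _ _).symm
        _ = ∑ j, f j • P.root (P.weylGroupToPerm w⁻¹ j) := by
          rw [P.weylGroup_apply_root w, hf, Finset.smul_sum]
          refine Finset.sum_congr rfl fun j _ => ?_
          rw [smul_comm, P.weylGroup_apply_root]
        _ = _ := by
          simp_rw [hg (P.weylGroupToPerm w⁻¹ _), Finset.smul_sum, Finset.sum_smul, mul_smul]
          exact Finset.sum_comm
    have h₂ (k : b.support) :
        ∑ j, f j * g (P.weylGroupToPerm w⁻¹ j) k = if i = k then 1 else 0 := by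
      have := congrArg (coord b k) h₁
      rw [coord_sum, coord_root] at this
      exact_mod_cast this.symm
    simp_rw [hg', Finset.mul_sum]
    rw [Finset.sum_comm, Finset.sum_congr rfl fun k _ => h₂ k, Finset.sum_ite_eq]
    simp
  have hterm (j : b.support) : -f j ≤ f j * b.height (P.weylGroupToPerm w⁻¹ j) := by
    by_cases hj : j ∈ I
    · have := hw.inv.not_isPos (simpleReflection_mem b hj)
      rw [b.isPos_iff'] at this
      nlinarith [hneg j]
    · simp [hfI j hj]
  obtain ⟨j, hj⟩ : ∃ j, f j ≠ 0 := by
    by_contra! h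
    simp [h] at hsum
  have hle : ∑ k, -f k ≤ 1 := hsum ▸ Finset.sum_le_sum fun k _ => hterm k
  rw [← Finset.add_sum_erase _ _ (Finset.mem_univ j)] at hle
  have hnn : ∀ k ∈ Finset.univ.erase j, 0 ≤ -f k := fun k _ => by linarith [hneg k]
  have hj' : f j ≤ -1 := by have := hneg j; omega
  have hzero : ∑ k ∈ Finset.univ.erase j, -f k = 0 :=
    le_antisymm (by linarith) (Finset.sum_nonneg hnn)
  rw [Finset.sum_eq_zero_iff_of_nonneg hnn] at hzero
  rw [Finset.sum_eq_zero (fun k hk => hzero k hk)] at hle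
  refine ⟨j, by_contra fun h => hj (hfI j h), ?_⟩
  rw [P.weylGroup_apply_root, hf, Finset.sum_eq_single j, show f j = -1 by omega, neg_one_smul]
  · intro k _ hk
    rw [show f k = 0 by simpa using hzero k (by simp [hk]), zero_smul]
  · simp

/-- Longest elements of a standard subgroup are involutions, and any two of them agree: their
product permutes the simple roots of the subgroup, and it keeps the other simple roots positive
because it does not change the coefficient at the root itself. -/
theorem IsLongest.mul_eq_one {b : P.Base} {I : Set b.support} {w v : P.weylGroup}
    (hw : IsLongest b (standardSubgroup b I) w) (hv : IsLongest b (standardSubgroup b I) v) :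
    w * v = 1 := by
  classical
  apply eq_one_of_forall_isPos b
  intro i
  by_cases hi : i ∈ I
  · obtain ⟨j, hj, h₁⟩ := hv.exists_smul_root_eq_neg hi
    obtain ⟨k, -, h₂⟩ := hw.exists_smul_root_eq_neg hj
    have : P.weylGroupToPerm (w * v) i = k := by
      apply P.root.injective
      rw [← P.weylGroup_apply_root, mul_smul, h₁, smul_neg, h₂, neg_neg]
    rw [this]
    exact b.isPos_of_mem_support k.2
  · apply isPos_of_coord_eq_one b (i := i)
    rw [← P.weylGroup_apply_root, coord_smul_of_mem b (mul_mem hw.1 hv.1) hi, coord_root]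
    simp

/-- The opposition involution `τ = -w` of the simple roots of a standard subgroup with longest
element `w`, extended by the identity to the other simple roots. -/
theorem IsLongest.exists_opposition {b : P.Base} {I : Set b.support} {w : P.weylGroup}
    (hw : IsLongest b (standardSubgroup b I) w) :
    ∃ τ : b.support → b.support, (∀ i ∈ I, τ i ∈ I) ∧ (∀ i ∉ I, τ i = i) ∧ (∀ i, τ (τ i) = i) ∧
      (∀ i ∈ I, w • P.root i = -P.root (τ i)) ∧
      ∀ i ∈ I, ∀ j ∈ I, b.cartanMatrix (τ i) (τ j) = b.cartanMatrix i j := by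
  classical
  have h (i : b.support) : ∃ j, (i ∈ I → j ∈ I ∧ w • P.root i = -P.root j) ∧
      (i ∉ I → j = i) := by
    by_cases hi : i ∈ I
    · obtain ⟨j, hj, h⟩ := hw.exists_smul_root_eq_neg hi
      exact ⟨j, fun _ => ⟨hj, h⟩, fun h => absurd hi h⟩
    · exact ⟨i, fun h => absurd h hi, fun _ => rfl⟩
  choose τ hτ hτ' using h
  refine ⟨τ, fun i hi => (hτ i hi).1, hτ', fun i => ?_, fun i hi => (hτ i hi).2,
    fun i hi j hj => ?_⟩
  · by_cases hi : i ∉ I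
    · rw [hτ' i hi, hτ' i hi]
    rw [not_not] at hi
    have h₁ : w • w • P.root i = P.root (τ (τ i)) := by
      rw [(hτ i hi).2, smul_neg, (hτ _ (hτ i hi).1).2, neg_neg]
    rw [← mul_smul, hw.mul_eq_one hw, one_smul] at h₁
    exact Subtype.ext (P.root.injective h₁.symm)
  · have key (k : b.support) (hk : k ∈ I) :
        P.weylGroupToPerm w k = P.reflectionPerm (τ k) (τ k) :=
      eq_reflectionPerm_of_root_eq_neg (by rw [← P.weylGroup_apply_root, (hτ k hk).2])
    have := coroot'_weylGroup_smul w j (P.root i)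
    rw [P.weylGroup_apply_root, key i hi, key j hj, P.root_coroot'_eq_pairing,
      P.root_coroot'_eq_pairing, P.pairing_reflectionPerm_self_left,
      P.pairing_reflectionPerm_self_right, neg_neg] at this
    apply (algebraMap ℤ K).injective_int
    rwa [b.algebraMap_cartanMatrixIn_apply ℤ, b.algebraMap_cartanMatrixIn_apply ℤ]

end

variable [P.IsRootSystem] [CharZero K] [Finite J] [P.IsCrystallographic] [P.IsReduced]

/-! ### The order `η` in terms of the Weyl group -/

theorem isLongest_longest_top (b : P.Base) :
    IsLongest b (standardSubgroup b Set.univ) (longest b ⊤) := by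
  rw [standardSubgroup_univ]
  exact (exists_isLongest b ⊤).choose_spec

theorem isLongest_longest_parabolic (b : P.Base) (β : b.support) :
    IsLongest b (standardSubgroup b {i | i ≠ β}) (longest b (parabolic b β)) :=
  (exists_isLongest b (parabolic b β)).choose_spec

/-- The element `w₀ w₀ᴾ` of the Weyl group, which induces `p ι` on `W / W_P`. -/
noncomputable def rotation (b : P.Base) (β : b.support) : P.weylGroup :=
  longest b ⊤ * longest b (parabolic b β)

theorem poincareDuality_mul_strangeDuality (b : P.Base) (β : b.support) :
    poincareDuality b β * strangeDuality b β =
      MulAction.toPermHom P.weylGroup (SchubertIndex b β) (rotation b β) :=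
  (map_mul (MulAction.toPermHom P.weylGroup (SchubertIndex b β)) _ _).symm

theorem eta_dvd_of_rotation_pow_eq_one {b : P.Base} {β : b.support} {m : ℕ}
    (h : rotation b β ^ m = 1) : eta b β ∣ m := by
  apply orderOf_dvd_of_pow_eq_one
  rw [poincareDuality_mul_strangeDuality, ← map_pow, h, map_one]

/-- If `(p ι)ᵐ = 1`, then `(w₀ w₀ᴾ)ᵐ` fixes the trivial coset, so it lies in `W_P`. -/
theorem coord_rotation_pow_of_eta_dvd {b : P.Base} {β : b.support} {m : ℕ} (h : eta b β ∣ m)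
    (x : M) : coord b β (rotation b β ^ m • x) = coord b β x := by
  have h₁ := orderOf_dvd_iff_pow_eq_one.mp h
  rw [poincareDuality_mul_strangeDuality, ← map_pow] at h₁
  have h₂ := congrArg (fun f => f ((1 : P.weylGroup) : SchubertIndex b β)) h₁
  have h₃ : ((rotation b β ^ m : P.weylGroup) : SchubertIndex b β) = (1 : P.weylGroup) := by
    simpa [MulAction.Quotient.smul_coe] using h₂
  have h₄ : rotation b β ^ m ∈ parabolic b β := by
    have := QuotientGroup.eq.mp h₃.symm
    simpa using this
  exact coord_smul_of_mem b h₄ (by simp) x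

theorem coord_longest_parabolic (b : P.Base) (β : b.support) (x : M) :
    coord b β (longest b (parabolic b β) • x) = coord b β x :=
  coord_smul_of_mem b (isLongest_longest_parabolic b β).1 (by simp) x

theorem coord_longest_top {b : P.Base} {σ : b.support → b.support} (hσ : ∀ i, σ (σ i) = i)
    (h : ∀ i : b.support, longest b ⊤ • P.root i = -P.root (σ i)) (j : b.support) (x : M) :
    coord b j (longest b ⊤ • x) = -coord b (σ j) x := by
  classical
  have := b.toWeightBasis.ext (f₁ := coord b j ∘ₗ DistribSMul.toLinearMap K M (longest b ⊤))
    (f₂ := -coord b (σ j)) (fun i => by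
      have : σ i = j ↔ i = σ j := ⟨fun h => by rw [← h, hσ], fun h => by rw [h, hσ]⟩
      simp [h, coord_root, this])
  exact congrArg (fun f => f x) this

/-- If `-w₀` fixes the simple root `β`, then `w₀ w₀ᴾ` negates the coefficient at `β` and permutes
the other simple roots, so its square keeps every simple root positive. -/
theorem eta_eq_two_of_longest_smul_root {b : P.Base} {β : b.support}
    (hβ : longest b ⊤ • P.root β = -P.root β) : eta b β = 2 := by
  classical
  obtain ⟨σ, -, -, hσσ, hσ, -⟩ := (isLongest_longest_top b).exists_opposition
  obtain ⟨τ, hτβ, -, -, hτ, -⟩ := (isLongest_longest_parabolic b β).exists_opposition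
  replace hσ := fun i => hσ i (Set.mem_univ i)
  have hσβ : σ β = β := by
    have := hσ β
    rw [hβ, neg_inj] at this
    exact (Subtype.ext (P.root.injective this)).symm
  have hcoord (x : M) : coord b β (rotation b β • x) = -coord b β x := by
    rw [rotation, mul_smul, coord_longest_top hσσ hσ, hσβ, coord_longest_parabolic]
  have hroot (i : b.support) (hi : i ≠ β) :
      σ (τ i) ≠ β ∧ rotation b β • P.root i = P.root (σ (τ i)) := by
    refine ⟨fun h => hτβ i hi ?_, ?_⟩
    · rw [← hσσ (τ i), h, hσβ]
    · rw [rotation, mul_smul, hτ i hi, smul_neg, hσ, neg_neg]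
  have h1 : ¬ eta b β ∣ 1 := fun h => by
    have := coord_rotation_pow_of_eta_dvd h (P.root β)
    rw [pow_one, hcoord, coord_root, if_pos rfl] at this
    norm_num at this
  have h2 : eta b β ∣ 2 := by
    apply eta_dvd_of_rotation_pow_eq_one
    apply eq_one_of_forall_isPos b
    intro i
    by_cases hi : i = β
    · apply isPos_of_coord_eq_one b (i := β)
      rw [← P.weylGroup_apply_root, pow_two, mul_smul, hcoord, hcoord, hi, coord_root]
      simp
    · obtain ⟨h₁, h₂⟩ := hroot i hi
      have : P.weylGroupToPerm (rotation b β ^ 2) i = σ (τ (σ (τ i))) := by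
        apply P.root.injective
        rw [← P.weylGroup_apply_root, pow_two, mul_smul, h₂, (hroot _ h₁).2]
      rw [this]
      exact b.isPos_of_mem_support (Subtype.prop _)
  rcases (Nat.dvd_prime Nat.prime_two).mp h2 with h | h
  · exact absurd h.dvd h1
  · exact h

/-! ### The order of the group generated by the three involutions -/

/-- Put `r = p i`.  Both `p` and `i` invert `r` under conjugation, so the products of the triples
`(rᵐ, rⁿ, r⁻ᵐ⁻ⁿ)` with `1` or `(p, p, i)` form a group, which is the group generated by the three
given triples.  These products are pairwise different unless `(p, p, i)` is itself such a triple
of powers, and then `i = (p p)⁻¹ = 1`. -/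
theorem card_closure_triples {G : Type*} [Group G] {p i : G} (hp : p * p = 1) (hi : i * i = 1)
    (hi1 : i ≠ 1) :
    Nat.card (Subgroup.closure {((p, p, i) : G × G × G), (p, i, p), (i, p, p)}) =
      2 * orderOf (p * i) ^ 2 := by
  set r := p * i with hr
  have hpr (m : ℤ) : p * r ^ m = r ^ (-m) * p := by
    have h : p * r * p⁻¹ = r⁻¹ := by
      rw [hr, mul_inv_rev, inv_eq_of_mul_eq_one_left hi, inv_eq_of_mul_eq_one_left hp,
        ← mul_assoc, hp, one_mul]
    rw [zpow_neg, ← inv_zpow, ← h, conj_zpow, inv_mul_cancel_right]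
  have hir (m : ℤ) : i * r ^ m = r ^ (-m) * i := by
    have h : i * r * i⁻¹ = r⁻¹ := by
      rw [hr, mul_inv_rev, inv_eq_of_mul_eq_one_left hi, inv_eq_of_mul_eq_one_left hp,
        mul_assoc, mul_assoc, hi, mul_one]
    rw [zpow_neg, ← inv_zpow, ← h, conj_zpow, inv_mul_cancel_right]
  let F : Subgroup.zpowers r × Subgroup.zpowers r × Bool → G × G × G := fun t =>
    (t.1 * bif t.2.2 then p else 1, t.2.1 * bif t.2.2 then p else 1,
      ((t.1 : G) * (t.2.1 : G))⁻¹ * bif t.2.2 then i else 1)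
  have hF (m n : ℤ) (ε : Bool) :
      F (⟨r ^ m, m, rfl⟩, ⟨r ^ n, n, rfl⟩, ε) = (r ^ m * bif ε then p else 1,
        r ^ n * bif ε then p else 1, r ^ (-m - n) * bif ε then i else 1) := by
    simp only [F, ← zpow_add, ← zpow_neg, neg_add']
  have hFinj : Function.Injective F := by
    -- if the `Bool` components differ, then `p = rᵃ = rᶜ` and `i = r⁻ᵃ⁻ᶜ` for some `a` and `c`
    have hne (m n m' n' : ℤ) (h : F (⟨r ^ m, m, rfl⟩, ⟨r ^ n, n, rfl⟩, false) =
        F (⟨r ^ m', m', rfl⟩, ⟨r ^ n', n', rfl⟩, true)) : False := by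
      simp only [hF, cond_true, cond_false, mul_one, Prod.mk.injEq] at h
      obtain ⟨h₁, h₂, h₃⟩ := h
      have e₁ : p = r ^ (m - m') := by
        rw [sub_eq_neg_add, zpow_add, h₁, zpow_neg, inv_mul_cancel_left]
      have e₂ : p = r ^ (n - n') := by
        rw [sub_eq_neg_add, zpow_add, h₂, zpow_neg, inv_mul_cancel_left]
      have e₃ : i = r ^ (-(m - m') - (n - n')) := by
        rw [show -(m - m') - (n - n') = -(-m' - n') + (-m - n) by ring, zpow_add, h₃,
          zpow_neg, inv_mul_cancel_left]
      apply hi1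
      rw [e₃, zpow_sub, zpow_neg, ← e₁, ← e₂, ← mul_inv_rev, hp, inv_one]
    rintro ⟨⟨_, m, rfl⟩, ⟨_, n, rfl⟩, ε⟩ ⟨⟨_, m', rfl⟩, ⟨_, n', rfl⟩, ε'⟩ h
    rcases ε with _ | _ <;> rcases ε' with _ | _
    · simp only [hF, cond_false, mul_one, Prod.mk.injEq] at h
      simp [h.1, h.2.1]
    · exact (hne _ _ _ _ h).elim
    · exact (hne _ _ _ _ h.symm).elim
    · simp only [hF, cond_true, Prod.mk.injEq, mul_left_inj] at h
      simp [h.1, h.2.1]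
  let S : Subgroup (G × G × G) :=
    { carrier := Set.range F
      one_mem' := ⟨(⟨r ^ (0 : ℤ), 0, rfl⟩, ⟨r ^ (0 : ℤ), 0, rfl⟩, false), by rw [hF]; simp⟩
      mul_mem' := by
        rintro _ _ ⟨⟨⟨_, m, rfl⟩, ⟨_, n, rfl⟩, ε⟩, rfl⟩ ⟨⟨⟨_, m', rfl⟩, ⟨_, n', rfl⟩, ε'⟩, rfl⟩
        rcases ε with _ | _
        · refine ⟨(⟨r ^ (m + m'), _, rfl⟩, ⟨r ^ (n + n'), _, rfl⟩, ε'), ?_⟩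
          simp only [hF, Prod.mk_mul_mk, cond_false, mul_one, ← mul_assoc, ← zpow_add]
          rw [show -(m + m') - (n + n') = -m - n + (-m' - n') by ring]
        · refine ⟨(⟨r ^ (m - m'), _, rfl⟩, ⟨r ^ (n - n'), _, rfl⟩, !ε'), ?_⟩
          rcases ε' with _ | _
          · simp only [hF, Prod.mk_mul_mk, cond_true, cond_false, mul_one, mul_assoc, hpr, hir,
              Bool.not_false]
            simp only [← mul_assoc, ← zpow_add]
            ring_nf
          · simp only [hF, Prod.mk_mul_mk, cond_true, cond_false, mul_one, Bool.not_true]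
            have e₁ (a c : ℤ) : r ^ a * p * (r ^ c * p) = r ^ (a - c) := by
              rw [mul_assoc, ← mul_assoc p, hpr, mul_assoc, hp, mul_one, ← zpow_add, sub_eq_add_neg]
            have e₂ (a c : ℤ) : r ^ a * i * (r ^ c * i) = r ^ (a - c) := by
              rw [mul_assoc, ← mul_assoc i, hir, mul_assoc, hi, mul_one, ← zpow_add, sub_eq_add_neg]
            rw [e₁, e₁, e₂, show -(m - m') - (n - n') = -m - n - (-m' - n') by ring]
      inv_mem' := by
        rintro _ ⟨⟨⟨_, m, rfl⟩, ⟨_, n, rfl⟩, ε⟩, rfl⟩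
        rcases ε with _ | _
        · refine ⟨(⟨r ^ (-m), _, rfl⟩, ⟨r ^ (-n), _, rfl⟩, false), ?_⟩
          simp only [hF, cond_false, mul_one, Prod.inv_mk, ← zpow_neg]
          rw [show -(-m) - -n = -(-m - n) by ring]
        · refine ⟨(⟨r ^ m, _, rfl⟩, ⟨r ^ n, _, rfl⟩, true), ?_⟩
          simp only [hF, cond_true, Prod.inv_mk, mul_inv_rev, ← zpow_neg,
            inv_eq_of_mul_eq_one_left hi, inv_eq_of_mul_eq_one_left hp, hpr, hir, neg_neg] }
  have hS : Subgroup.closure {((p, p, i) : G × G × G), (p, i, p), (i, p, p)} = S := by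
    have hri : r * i = p := by rw [hr, mul_assoc, hi, mul_one]
    have hrp : r⁻¹ * p = i := by
      rw [hr, mul_inv_rev, inv_eq_of_mul_eq_one_left hp, mul_assoc, hp, mul_one,
        inv_eq_of_mul_eq_one_left hi]
    apply Subgroup.closure_eq_of_le
    · rintro _ (rfl | rfl | rfl)
      · exact ⟨(⟨r ^ (0 : ℤ), _, rfl⟩, ⟨r ^ (0 : ℤ), _, rfl⟩, true), by rw [hF]; simp⟩
      · exact ⟨(⟨r ^ (0 : ℤ), _, rfl⟩, ⟨r ^ (-1 : ℤ), _, rfl⟩, true), by rw [hF]; simp [hri, hrp]⟩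
      · exact ⟨(⟨r ^ (-1 : ℤ), _, rfl⟩, ⟨r ^ (0 : ℤ), _, rfl⟩, true), by rw [hF]; simp [hri, hrp]⟩
    · rintro _ ⟨⟨⟨_, m, rfl⟩, ⟨_, n, rfl⟩, ε⟩, rfl⟩
      set H := Subgroup.closure {((p, p, i) : G × G × G), (p, i, p), (i, p, p)}
      have hA : (p, p, i) ∈ H := Subgroup.subset_closure (by simp)
      have hB : (p, i, p) ∈ H := Subgroup.subset_closure (by simp)
      have hC : (i, p, p) ∈ H := Subgroup.subset_closure (by simp)
      have hip : i * p = r⁻¹ := by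
        rw [hr, mul_inv_rev, inv_eq_of_mul_eq_one_left hp, inv_eq_of_mul_eq_one_left hi]
      have hE : F (⟨r ^ m, m, rfl⟩, ⟨r ^ n, n, rfl⟩, false) ∈ H := by
        convert mul_mem (zpow_mem (mul_mem hA hC) m) (zpow_mem (mul_mem hA hB) n) using 1
        simp only [hF, Prod.mk_mul_mk, hp, hip, ← hr]
        simp [sub_eq_add_neg, zpow_add]
      rcases ε with _ | _
      · exact hE
      · convert mul_mem hE hA using 1
        simp only [hF, Prod.mk_mul_mk, cond_true, cond_false, mul_one]
  rw [hS]
  change Nat.card (Set.range F) = _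
  rw [Nat.card_range_of_injective hFinj, Nat.card_prod, Nat.card_prod, Nat.card_zpowers]
  simp
  ring

/-- If `ι` were trivial, then `w = w₀ᴾ` would fix the coset of `s_β`, and `s_β w s_β ∈ W_P` would
preserve the coefficient at `β`, so that `w` would preserve the pairing with `β^∨`.  But `w` maps a
simple root `α` that is joined to `β` to the negative of a simple root other than `β`, and
`⟨α, β^∨⟩ < 0`. -/
theorem strangeDuality_ne_one {b : P.Base} {β : b.support} (hP : P.IsIrreducible)
    (hcard : 2 ≤ b.support.card) : strangeDuality b β ≠ 1 := by
  classical
  intro hone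
  obtain ⟨τ, hτβ, -, -, hτ, -⟩ := (isLongest_longest_parabolic b β).exists_opposition
  set w := longest b (parabolic b β) with hw
  obtain ⟨α, hα, hαβ⟩ : ∃ α, α ≠ β ∧ b.cartanMatrix α β ≠ 0 := by
    by_contra! h
    have hall (j : b.support) : j = β :=
      b.induction_on_cartanMatrix (fun i => i = β) rfl fun i j hi hij => by
        by_contra hj
        exact hij (hi ▸ h j hj)
    have : Fintype.card b.support ≤ 1 := Fintype.card_le_one_iff.mpr fun i j => by
      rw [hall i, hall j]
    simp at this
    omega
  have hneg : b.cartanMatrix α β < 0 := lt_of_le_of_ne (b.cartanMatrix_le_zero_of_ne _ _ hα) hαβ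
  have hmem : (simpleReflection b β)⁻¹ * (w * simpleReflection b β) ∈ parabolic b β := by
    have h₁ := congrArg (fun f => f (simpleReflection b β : SchubertIndex b β)) hone
    have h₂ : ((w * simpleReflection b β : P.weylGroup) : SchubertIndex b β) =
      simpleReflection b β := h₁
    exact QuotientGroup.eq.mp h₂.symm
  have hs (y : M) : coord b β (simpleReflection b β • y) = coord b β y - P.coroot' β y := by
    simp [simpleReflection_smul, coord_root]
  have key (x : M) : P.coroot' β (w • x) = P.coroot' β x := by
    have h := coord_smul_of_mem b hmem (i := β) (by simp) (simpleReflection b β • x)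
    rw [mul_smul, mul_smul, simpleReflection_inv, ← mul_smul (simpleReflection b β) _ x,
      simpleReflection_mul_self, one_smul, hs, hs, coord_longest_parabolic] at h
    exact sub_right_injective h
  have h := key (P.root α)
  rw [hτ α hα, map_neg, P.root_coroot'_eq_pairing, P.root_coroot'_eq_pairing,
    ← b.algebraMap_cartanMatrixIn_apply ℤ, ← b.algebraMap_cartanMatrixIn_apply ℤ, ← map_neg] at h
  have h' := (algebraMap ℤ K).injective_int h
  have hle := b.cartanMatrix_le_zero_of_ne (τ α) β (hτβ α hα)
  rw [RootPairing.Base.cartanMatrix] at hle hneg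
  omega

theorem longest_top_mul_self (b : P.Base) : longest b ⊤ * longest b ⊤ = 1 :=
  (isLongest_longest_top b).mul_eq_one (isLongest_longest_top b)

theorem longest_parabolic_mul_self (b : P.Base) (β : b.support) :
    longest b (parabolic b β) * longest b (parabolic b β) = 1 :=
  (isLongest_longest_parabolic b β).mul_eq_one (isLongest_longest_parabolic b β)

theorem card_symmetryGroup {b : P.Base} {β : b.support} (hP : P.IsIrreducible)
    (hcard : 2 ≤ b.support.card) :
    Nat.card (symmetryGroup b β) = 2 * eta b β ^ 2 := by
  let X := SchubertIndex b β
  let φ : Equiv.Perm X × Equiv.Perm X × Equiv.Perm X →* Equiv.Perm (X × X × X) :=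
    { toFun t := Equiv.prodCongr t.1 (Equiv.prodCongr t.2.1 t.2.2)
      map_one' := rfl
      map_mul' _ _ := rfl }
  have hφ : Function.Injective φ := by
    rintro ⟨f, g, h⟩ ⟨f', g', h'⟩ e
    have x₀ : X := ((1 : P.weylGroup) : SchubertIndex b β)
    have key (x y z : X) : (f x, g y, h z) = (f' x, g' y, h' z) :=
      congrArg (fun F => F (x, y, z)) e
    refine Prod.ext (Equiv.ext fun x => ?_)
      (Prod.ext (Equiv.ext fun y => ?_) (Equiv.ext fun z => ?_))
    · exact congrArg Prod.fst (key x x₀ x₀)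
    · exact congrArg (fun t => t.2.1) (key x₀ y x₀)
    · exact congrArg (fun t => t.2.2) (key x₀ x₀ z)
  have hp : poincareDuality b β * poincareDuality b β = 1 := by
    refine (map_mul (MulAction.toPermHom P.weylGroup X) _ _).symm.trans ?_
    rw [longest_top_mul_self, map_one]
  have hi : strangeDuality b β * strangeDuality b β = 1 := by
    refine (map_mul (MulAction.toPermHom P.weylGroup X) _ _).symm.trans ?_
    rw [longest_parabolic_mul_self, map_one]
  rw [eta, ← card_closure_triples hp hi (strangeDuality_ne_one hP hcard)]
  symm
  refine (Nat.card_congr (Subgroup.equivMapOfInjective _ φ hφ).toEquiv).trans ?_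
  rw [MonoidHom.map_closure]
  simp only [symmetryGroup, Set.image_insert_eq, Set.image_singleton]
  rfl

/-! ### The two longest elements in terms of a numbering of the simple roots -/

/-- The action of `w₀` and `w₀ᴾ` on the simple roots `root i`, numbered so that the Cartan matrix
is `A` and `β` has number `k`: the opposition involutions `σ = -w₀` of the Dynkin diagram and
`τ = -w₀ᴾ` of the diagram without `β`, the latter extended by `τ k = k`. -/
structure NumberedOpposition (b : P.Base) (β : b.support) {n : ℕ}
    (A : Matrix (Fin n) (Fin n) ℤ) (k : Fin n) where
  /-- The simple root with a given number. -/
  root : Fin n → M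
  root_self : root k = P.root β
  coord_root_ne : ∀ i, i ≠ k → coord b β (root i) = 0
  ext : ∀ w : P.weylGroup, (∀ i, w • root i = root i) → w = 1
  /-- The opposition involution of the whole diagram. -/
  σ : Fin n → Fin n
  σ_σ : ∀ i, σ (σ i) = i
  cartan_σ : ∀ i j, A (σ i) (σ j) = A i j
  top_smul : ∀ i, longest b ⊤ • root i = -root (σ i)
  /-- `w₀` acts trivially on the weights modulo the root lattice, in particular on `∑ yᵢ αᵢ / d`. -/
  dvd_σ : ∀ (d : ℤ) (y : Fin n → ℤ), (∀ j, d ∣ ∑ i, y i * A i j) → ∀ j, d ∣ y j + y (σ j)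
  /-- The opposition involution of the diagram without `β`. -/
  τ : Fin n → Fin n
  τ_τ : ∀ i, τ (τ i) = i
  τ_self : τ k = k
  cartan_τ : ∀ i j, i ≠ k → j ≠ k → A (τ i) (τ j) = A i j
  parabolic_smul : ∀ i, i ≠ k → longest b (parabolic b β) • root i = -root (τ i)
  /-- The analogue of `dvd_σ` for the root system spanned by the simple roots other than `β`. -/
  dvd_τ : ∀ (d : ℤ) (y : Fin n → ℤ), y k = 0 → (∀ j, j ≠ k → d ∣ ∑ i, y i * A i j) →
    ∀ j, d ∣ y j + y (τ j)
  /-- `w₀ᴾ` fixes the vectors that are orthogonal to all simple coroots other than `β^∨`. -/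
  parabolic_smul_sum : ∀ u : Fin n → ℤ, (∀ j, j ≠ k → ∑ i, u i * A i j = 0) →
    longest b (parabolic b β) • ∑ i, u i • root i = ∑ i, u i • root i

theorem sum_comp_involution {ι A : Type*} [Fintype ι] [AddCommMonoid A] {ρ : ι → ι}
    (hρ : Function.Involutive ρ) (f : ι → A) : ∑ i, f (ρ i) = ∑ i, f i :=
  Equiv.sum_comp hρ.toPerm f

theorem HasType.nonempty_numberedOpposition {b : P.Base} {β : b.support} {n : ℕ}
    {A : Matrix (Fin n) (Fin n) ℤ} {k : Fin n} (h : HasType b β A k) :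
    Nonempty (NumberedOpposition b β A k) := by
  classical
  obtain ⟨e, hA, rfl⟩ := h
  obtain ⟨σ, -, -, hσσ, hσ, hσA⟩ := (isLongest_longest_top b).exists_opposition
  obtain ⟨τ, hτβ, hτβ', hττ, hτ, hτA⟩ := (isLongest_longest_parabolic b β).exists_opposition
  replace hσ := fun i => hσ i (Set.mem_univ i)
  have hA' (i j : Fin n) : A i j = b.cartanMatrix (e.symm i) (e.symm j) := by simp [hA]
  have hne (i : Fin n) : i ≠ e β ↔ e.symm i ≠ β := by rw [ne_eq, ne_eq, e.symm_apply_eq]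
  have hsum (y : Fin n → ℤ) (j : b.support) :
      ∑ i, y (e i) * b.cartanMatrix i j = ∑ i, y i * A i (e j) := by
    rw [← e.sum_comp]
    simp [hA]
  have hsum' (y : Fin n → ℤ) :
      ∑ i, y i • P.root (e.symm i) = ∑ i : b.support, y (e i) • P.root i := by
    rw [← e.sum_comp]
    simp
  -- compare coordinates in `w x = x + d z` for `x = ∑ yᵢ αᵢ`
  have hdvd {I : Set b.support} {w : P.weylGroup} (hw : w ∈ standardSubgroup b I)
      (ρ : b.support → b.support) (hρ : ∀ i, ρ (ρ i) = i) (d : ℤ) (y : Fin n → ℤ)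
      (hwρ : ∀ i, y (e i) • w • P.root i = y (e i) • -P.root (ρ i))
      (hy : ∀ j ∈ I, d ∣ ∑ i, y i * A i (e j)) (j : Fin n) :
      d ∣ y j + y (e (ρ (e.symm j))) := by
    obtain ⟨z, hz⟩ := exists_smul_eq_add_smul_sum b hw (d := d) (y := fun i => y (e i))
      (fun j hj => by rw [hsum]; exact hy j hj)
    have h₁ : w • ∑ i : b.support, y (e i) • P.root i =
        ∑ i : b.support, (-y (e (ρ i))) • P.root i := by
      rw [Finset.smul_sum, ← sum_comp_involution hρ]
      refine Finset.sum_congr rfl fun i _ => ?_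
      rw [smul_comm, hwρ, hρ, smul_neg, neg_smul]
    rw [h₁] at hz
    have h₂ := congrArg (coord b (e.symm j)) hz
    rw [coord_sum, coord_sum] at h₂
    have h₃ : -y (e (ρ (e.symm j))) = y (e (e.symm j)) + d * z (e.symm j) := by exact_mod_cast h₂
    rw [e.apply_symm_apply] at h₃
    exact ⟨-z (e.symm j), by linarith⟩
  refine ⟨{
    root := fun i => P.root (e.symm i)
    root_self := by simp
    coord_root_ne := fun i hi => by rw [coord_root, if_neg ((hne i).mp hi)]
    ext := fun w hw => weylGroup_ext_base b fun i => by
      rw [one_smul]; simpa using hw (e i)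
    σ := fun i => e (σ (e.symm i))
    σ_σ := fun i => by simp [hσσ]
    cartan_σ := fun i j => by
      rw [← hA, hA']; exact hσA _ (Set.mem_univ _) _ (Set.mem_univ _)
    top_smul := fun i => by rw [hσ]; simp
    dvd_σ := fun d y hy j => by
      refine hdvd (isLongest_longest_top b).1 σ hσσ d y (fun i => by rw [hσ]) (fun j _ => hy _) j
    τ := fun i => e (τ (e.symm i))
    τ_τ := fun i => by simp [hττ]
    τ_self := by simp [hτβ' β (by simp)]
    cartan_τ := fun i j hi hj => by
      rw [← hA, hA']; exact hτA _ ((hne i).mp hi) _ ((hne j).mp hj)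
    parabolic_smul := fun i hi => by rw [hτ _ ((hne i).mp hi)]; simp
    dvd_τ := fun d y hk hy j => by
      refine hdvd (isLongest_longest_parabolic b β).1 τ hττ d y (fun i => ?_)
        (fun j hj => hy _ (by simpa using hj)) j
      by_cases hi : i = β
      · rw [hi, hk, zero_smul, zero_smul]
      · rw [hτ i hi]
    parabolic_smul_sum := fun u hu => ?_ }⟩
  obtain ⟨z, hz⟩ := exists_smul_eq_add_smul_sum b (isLongest_longest_parabolic b β).1 (d := 0)
    (y := fun i => u (e i)) (fun j hj => by rw [hsum, hu _ (by simpa using hj)])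
  rw [hsum', hz]
  simp

namespace NumberedOpposition

variable {b : P.Base} {β : b.support} {n : ℕ} {A : Matrix (Fin n) (Fin n) ℤ} {k : Fin n}
  (D : NumberedOpposition b β A k)

include D

/-- The vector `∑ uᵢ αᵢ` is a multiple of the fundamental weight at `β`, hence fixed by `w₀ᴾ`.
Since `w₀ᴾ` maps `αᵢ` to `-α_{τ i}` for `i ≠ k`, this determines the image `θ` of `α_k`. -/
theorem parabolic_smul_root_self {u θ : Fin n → ℤ} (hu : ∀ j, j ≠ k → ∑ i, u i * A i j = 0)
    (huk : u k ≠ 0) (hk : θ k = 1) (hθ : ∀ i, i ≠ k → u k * θ i = u i + u (D.τ i)) :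
    longest b (parabolic b β) • D.root k = ∑ i, θ i • D.root i := by
  classical
  have h₁ := D.parabolic_smul_sum u hu
  have hpar (i : Fin n) (hi : i ∈ univ.erase k) :
      longest b (parabolic b β) • u i • D.root i = -(u i • D.root (D.τ i)) := by
    rw [smul_comm, D.parabolic_smul i (Finset.ne_of_mem_erase hi), smul_neg]
  have h₂ : ∑ i ∈ univ.erase k, u i • D.root (D.τ i) =
      ∑ i ∈ univ.erase k, u (D.τ i) • D.root i := by
    have := sum_comp_involution D.τ_τ (fun i => u (D.τ i) • D.root i)
    simp only [D.τ_τ] at this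
    rw [← Finset.add_sum_erase _ _ (mem_univ k), ← Finset.add_sum_erase _ _ (mem_univ k),
      D.τ_self] at this
    exact add_left_cancel this
  rw [Finset.smul_sum, ← Finset.add_sum_erase _ _ (mem_univ k),
    Finset.sum_congr rfl hpar, Finset.sum_neg_distrib, h₂,
    ← Finset.add_sum_erase univ (fun i => u i • D.root i) (mem_univ k), add_neg_eq_iff_eq_add,
    add_assoc, ← Finset.sum_add_distrib, smul_comm] at h₁
  have h₃ : ((u k : ℤ) : K) ≠ 0 := by exact_mod_cast huk
  apply smul_right_injective M h₃
  simp only [Int.cast_smul_eq_zsmul]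
  rw [h₁, Finset.smul_sum, ← Finset.add_sum_erase univ _ (mem_univ k), hk, one_smul]
  congr 1
  refine Finset.sum_congr rfl fun i hi => ?_
  rw [smul_smul, hθ i (Finset.ne_of_mem_erase hi), add_smul]

theorem rotation_smul {i : Fin n} (hi : i ≠ k) :
    rotation b β • D.root i = D.root (D.σ (D.τ i)) := by
  rw [rotation, mul_smul, D.parabolic_smul i hi, smul_neg, D.top_smul, neg_neg]

theorem rotation_smul_self {θ : Fin n → ℤ}
    (hθ : longest b (parabolic b β) • D.root k = ∑ i, θ i • D.root i)
    (hσ : ∀ i, θ (D.σ i) = θ i) :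
    rotation b β • D.root k = -∑ i, θ i • D.root i := by
  rw [rotation, mul_smul, hθ, Finset.smul_sum,
    ← sum_comp_involution D.σ_σ, ← Finset.sum_neg_distrib]
  refine Finset.sum_congr rfl fun i _ => ?_
  rw [smul_comm, D.top_smul, D.σ_σ, hσ, smul_neg]

theorem rotation_smul_neg_sum {θ : Fin n → ℤ}
    (hθ : longest b (parabolic b β) • D.root k = ∑ i, θ i • D.root i) :
    rotation b β • -∑ i, θ i • D.root i = D.root (D.σ k) := by
  rw [rotation, mul_smul, ← hθ, smul_neg, ← mul_smul (longest b (parabolic b β)),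
    longest_parabolic_mul_self, one_smul, smul_neg, D.top_smul, neg_neg]

theorem coord_root_self : coord b β (D.root k) = 1 := by
  classical
  rw [D.root_self, coord_root, if_pos rfl]

theorem eta_dvd {m : ℕ} (h : ∀ i, rotation b β ^ m • D.root i = D.root i) : eta b β ∣ m :=
  eta_dvd_of_rotation_pow_eq_one (D.ext _ h)

theorem coord_pow_smul_of_eta_dvd {m : ℕ} (h : eta b β ∣ m) :
    coord b β (rotation b β ^ m • D.root k) = 1 := by
  rw [coord_rotation_pow_of_eta_dvd h, D.coord_root_self]

theorem eta_eq_two (h : D.σ k = k) : eta b β = 2 :=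
  eta_eq_two_of_longest_smul_root (by rw [← D.root_self, D.top_smul, h])

end NumberedOpposition

variable {b : P.Base} {β : b.support}

/-! ### The symplectic and exceptional types -/

theorem eta_typeC {m : ℕ} (h : HasType b β (CartanMatrix.C (m + 1)) (Fin.last m)) :
    eta b β = 2 := by
  obtain ⟨D⟩ := h.nonempty_numberedOpposition
  apply D.eta_eq_two
  rcases m with _ | m
  · exact Subsingleton.elim (α := Fin 1) _ _
  · -- the long simple root is the only row of the Cartan matrix with an entry `-2`, so `σ` fixes it
    have hrow (i j : Fin (m + 2)) (hij : CartanMatrix.C (m + 2) i j = -2) :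
        i = Fin.last (m + 1) := by
      simp only [CartanMatrix.C, Matrix.of_apply] at hij
      split_ifs at hij <;> first | omega | exact Fin.ext (by assumption)
    apply hrow _ (D.σ (Fin.last m).castSucc)
    rw [D.cartan_σ]
    simp [CartanMatrix.C, Fin.ext_iff, add_assoc]

/-- Node `i` of a Dynkin diagram is joined to node `j`, and the entry of the Cartan matrix in
row `i` and column `j` is `-1`. -/
def SimplyLinked {n : ℕ} (A : Matrix (Fin n) (Fin n) ℤ) (i j : Fin n) : Prop := A i j = -1

instance {n : ℕ} (A : Matrix (Fin n) (Fin n) ℤ) (i j : Fin n) : Decidable (SimplyLinked A i j) :=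
  inferInstanceAs (Decidable (A i j = -1))

theorem eta_typeE₇ (h : HasType b β CartanMatrix.E₇ 6) : eta b β = 2 := by
  obtain ⟨D⟩ := h.nonempty_numberedOpposition
  apply D.eta_eq_two
  have hinj : Function.Injective D.σ := (show Function.Involutive D.σ from D.σ_σ).injective
  have hσ (i j : Fin 7) : CartanMatrix.E₇ (D.σ i) (D.σ j) = CartanMatrix.E₇ i j := D.cartan_σ i j
  -- the branch node of the Dynkin diagram is fixed, hence so is the end of its longest arm
  have branch : ∀ c u v w : Fin 7, (SimplyLinked CartanMatrix.E₇ c u ∧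
      SimplyLinked CartanMatrix.E₇ c v ∧ SimplyLinked CartanMatrix.E₇ c w ∧
      u ≠ v ∧ u ≠ w ∧ v ≠ w) → c = 3 := by
    decide +kernel
  have arm : ∀ u v w : Fin 7, (SimplyLinked CartanMatrix.E₇ 3 u ∧
      SimplyLinked CartanMatrix.E₇ u v ∧ v ≠ 3 ∧
      SimplyLinked CartanMatrix.E₇ v w ∧ w ≠ u) → w = 6 := by
    decide +kernel
  have h3 : D.σ 3 = 3 := branch _ (D.σ 1) (D.σ 2) (D.σ 4) ⟨hσ 3 1, hσ 3 2, hσ 3 4,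
    hinj.ne (by decide), hinj.ne (by decide), hinj.ne (by decide)⟩
  refine arm (D.σ 4) (D.σ 5) _ ⟨?_, hσ 4 5, ?_, hσ 5 6, hinj.ne (by decide)⟩
  · rw [← h3]
    exact hσ 3 4
  · rw [← h3]
    exact hinj.ne (by decide)

/-- Here `w₀ w₀ᴾ` rotates the extended Dynkin diagram, which has three arms of equal length. -/
theorem eta_typeE₆ (h : HasType b β CartanMatrix.E₆ 0) : eta b β = 3 := by
  obtain ⟨D⟩ := h.nonempty_numberedOpposition
  have hσ (i j : Fin 6) : CartanMatrix.E₆ (D.σ i) (D.σ j) = CartanMatrix.E₆ i j := D.cartan_σ i j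
  have hτ (i j : Fin 6) (hi : i ≠ 0) (hj : j ≠ 0) :
      CartanMatrix.E₆ (D.τ i) (D.τ j) = CartanMatrix.E₆ i j := D.cartan_τ i j hi hj
  have hσinj : Function.Injective D.σ := (show Function.Involutive D.σ from D.σ_σ).injective
  have hτinj : Function.Injective D.τ := (show Function.Involutive D.τ from D.τ_τ).injective
  -- three times the first fundamental weight
  have hσ3 := D.dvd_σ 3 ![4, 3, 5, 6, 4, 2] (by decide)
  -- four times a spin weight of the subdiagram of type `D₅`
  have hτ4 := D.dvd_τ 4 ![0, 3, 5, 6, 4, 2] (by decide) (by decide)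
  have s3 : D.σ 3 = 3 := by
    have branch : ∀ c u v w : Fin 6, (SimplyLinked CartanMatrix.E₆ c u ∧
        SimplyLinked CartanMatrix.E₆ c v ∧ SimplyLinked CartanMatrix.E₆ c w ∧
        u ≠ v ∧ u ≠ w ∧ v ≠ w) → c = 3 := by
      decide +kernel
    exact branch _ (D.σ 1) (D.σ 2) (D.σ 4) ⟨hσ 3 1, hσ 3 2, hσ 3 4,
      hσinj.ne (by decide), hσinj.ne (by decide), hσinj.ne (by decide)⟩
  have hσ' (i : Fin 6) : CartanMatrix.E₆ 3 (D.σ i) = CartanMatrix.E₆ 3 i := by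
    rw [← hσ 3 i, s3]
  obtain ⟨s0, s2⟩ : D.σ 0 = 5 ∧ D.σ 2 = 4 := by
    have arm : ∀ u v : Fin 6, (SimplyLinked CartanMatrix.E₆ 3 v ∧
        SimplyLinked CartanMatrix.E₆ v u ∧ u ≠ 3 ∧
        (3 : ℤ) ∣ 4 + ![4, 3, 5, 6, 4, 2] u) → u = 5 ∧ v = 4 := by
      decide +kernel
    exact arm _ _ ⟨hσ' 2, hσ 2 0, s3 ▸ hσinj.ne (by decide), hσ3 0⟩
  have s5 : D.σ 5 = 0 := s0 ▸ D.σ_σ 0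
  have s4 : D.σ 4 = 2 := s2 ▸ D.σ_σ 2
  have s1 : D.σ 1 = 1 := by
    have arm : ∀ u : Fin 6, (SimplyLinked CartanMatrix.E₆ 3 u ∧ u ≠ 4 ∧ u ≠ 2) → u = 1 := by
      decide +kernel
    exact arm _ ⟨hσ' 1, s2 ▸ hσinj.ne (by decide), s4 ▸ hσinj.ne (by decide)⟩
  have t0 : D.τ 0 = 0 := D.τ_self
  have t1 : D.τ 1 = 2 := by
    have : ∀ u : Fin 6, (4 : ℤ) ∣ 3 + ![0, 3, 5, 6, 4, 2] u → u = 2 := by decide +kernel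
    exact this _ (hτ4 1)
  have t2 : D.τ 2 = 1 := t1 ▸ D.τ_τ 1
  have t3 : D.τ 3 = 3 := by
    have arm : ∀ u : Fin 6, (SimplyLinked CartanMatrix.E₆ 2 u ∧ u ≠ 0) → u = 3 := by decide +kernel
    refine arm _ ⟨?_, fun h => absurd (hτinj (h.trans t0.symm)) (by decide)⟩
    rw [← t1]
    exact hτ 1 3 (by decide) (by decide)
  have t4 : D.τ 4 = 4 := by
    have arm : ∀ u : Fin 6, (SimplyLinked CartanMatrix.E₆ 3 u ∧ u ≠ 1 ∧ u ≠ 2) → u = 4 := by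
      decide +kernel
    refine arm _ ⟨?_, t2 ▸ hτinj.ne (by decide), t1 ▸ hτinj.ne (by decide)⟩
    nth_rw 1 [← t3]
    exact hτ 3 4 (by decide) (by decide)
  have t5 : D.τ 5 = 5 := by
    have arm : ∀ u : Fin 6, (SimplyLinked CartanMatrix.E₆ 4 u ∧ u ≠ 3) → u = 5 := by decide +kernel
    refine arm _ ⟨?_, t3 ▸ hτinj.ne (by decide)⟩
    nth_rw 1 [← t4]
    exact hτ 4 5 (by decide) (by decide)
  -- the highest root
  let θ : Fin 6 → ℤ := ![1, 2, 2, 3, 2, 1]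
  have hθ := D.parabolic_smul_root_self (u := ![4, 3, 5, 6, 4, 2]) (θ := θ) (by decide) (by decide)
    rfl (fun i hi => by
      fin_cases i
      · exact absurd rfl hi
      all_goals simp [θ, t1, t2, t3, t4, t5])
  have r0 := D.rotation_smul_self hθ (fun i => by fin_cases i <;> simp [θ, s0, s1, s2, s3, s4, s5])
  have rθ := D.rotation_smul_neg_sum hθ
  have r1 := D.rotation_smul (i := 1) (by decide)
  have r2 := D.rotation_smul (i := 2) (by decide)
  have r3 := D.rotation_smul (i := 3) (by decide)
  have r4 := D.rotation_smul (i := 4) (by decide)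
  have r5 := D.rotation_smul (i := 5) (by decide)
  rw [t1, s2] at r1
  rw [t2, s1] at r2
  rw [t3, s3] at r3
  rw [t4, s4] at r4
  rw [t5, s5] at r5
  rw [s0] at rθ
  have h3 : eta b β ∣ 3 := D.eta_dvd fun i => by
    rw [pow_three, mul_smul, mul_smul]
    fin_cases i
    · change rotation b β • rotation b β • rotation b β • D.root 0 = D.root 0
      rw [r0, rθ, r5]
    · change rotation b β • rotation b β • rotation b β • D.root 1 = D.root 1
      rw [r1, r4, r2]
    · change rotation b β • rotation b β • rotation b β • D.root 2 = D.root 2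
      rw [r2, r1, r4]
    · change rotation b β • rotation b β • rotation b β • D.root 3 = D.root 3
      rw [r3, r3, r3]
    · change rotation b β • rotation b β • rotation b β • D.root 4 = D.root 4
      rw [r4, r2, r1]
    · change rotation b β • rotation b β • rotation b β • D.root 5 = D.root 5
      rw [r5, r0, rθ]
  have h2 : ¬ eta b β ∣ 1 := fun h => by
    have h₂ := D.coord_pow_smul_of_eta_dvd (m := 2) (h.trans (one_dvd 2))
    rw [pow_two, mul_smul, r0, rθ, D.coord_root_ne 5 (by decide)] at h₂
    exact zero_ne_one h₂
  rcases (Nat.dvd_prime Nat.prime_three).mp h3 with h | h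
  · exact absurd h.dvd h2
  · exact h

/-! ### The linear type -/

/-- Multiplying a vector by the Cartan matrix of type `A` takes its negated second difference.  The
coefficient of node `i` is `Y (i + 1)`, and the vector is extended by `Y 0 = 0`. -/
theorem sum_mul_cartanMatrixA {m : ℕ} (Y : ℕ → ℤ) (hY : Y 0 = 0) (j : Fin m) :
    ∑ i : Fin m, Y (i + 1) * CartanMatrix.A m i j =
      2 * Y (j + 1) - Y j - if (j : ℕ) + 1 < m then Y (j + 2) else 0 := by
  obtain ⟨j, hj⟩ := j
  have h (i : Fin m) : Y (i + 1) * CartanMatrix.A m i ⟨j, hj⟩ =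
      (if j = i then 2 * Y (i + 1) else 0) - (if j = i + 1 then Y (i + 1) else 0) -
        (if j + 1 = i then Y (i + 1) else 0) := by
    simp only [CartanMatrix.A, Matrix.of_apply, Fin.ext_iff]
    split_ifs <;> omega
  simp only [h, Fin.sum_univ_eq_sum_range (fun i => (if j = i then 2 * Y (i + 1) else 0) -
    (if j = i + 1 then Y (i + 1) else 0) - (if j + 1 = i then Y (i + 1) else 0)),
    Finset.sum_sub_distrib, Finset.sum_ite_eq, Finset.mem_range, if_pos hj]
  congr 2
  rcases j with _ | j
  · simp [hY]
  · simp only [Nat.add_right_cancel_iff, Finset.sum_ite_eq, Finset.mem_range,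
      if_pos (Nat.lt_of_succ_lt hj)]

/-- Here `-w₀` and `-w₀ᴾ` reverse the diagram and the two parts of it that `β` separates.  Hence
`w₀ w₀ᴾ` rotates the extended Dynkin diagram, a cycle with `n` nodes, by `p` steps. -/
theorem eta_typeA {p n : ℕ} (hp : 0 < p) (hpn : p < n)
    {k : Fin (n - 1)} (hkp : (k : ℕ) = p - 1) (h : HasType b β (CartanMatrix.A (n - 1)) k) :
    eta b β = n / Nat.gcd p (n - p) := by
  have hk : p - 1 < n - 1 := Nat.sub_lt_sub_right hp hpn
  obtain rfl : k = ⟨p - 1, hk⟩ := Fin.ext hkp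
  obtain ⟨D⟩ := h.nonempty_numberedOpposition
  have hne (i : Fin (n - 1)) : i ≠ ⟨p - 1, hk⟩ ↔ (i : ℕ) + 1 ≠ p := by
    refine not_congr ⟨fun h => ?_, fun h => Fin.ext (Nat.eq_sub_of_add_eq h)⟩
    rw [h]
    exact Nat.sub_add_cancel hp
  -- the fundamental weight at the last node, times `n`
  have hσ (j : Fin (n - 1)) : (D.σ j : ℕ) + 1 = n - (j + 1) := by
    have h₁ := D.dvd_σ n (fun i => ((i + 1 : ℕ) : ℤ)) (fun j => by
      have hsum := sum_mul_cartanMatrixA (fun i => (i : ℤ)) Nat.cast_zero j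
      have := j.2
      split_ifs at hsum with hj
      · exact ⟨0, hsum.trans (by omega)⟩
      · exact ⟨1, hsum.trans (by omega)⟩) j
    have h₂ : n ∣ (j + 1) + (D.σ j + 1) := by exact_mod_cast h₁
    have := j.2
    have := (D.σ j).2
    have := Nat.eq_of_dvd_of_lt_two_mul (by omega) h₂ (by omega)
    omega
  -- the last fundamental weight, times `p`, for the simple roots before `β`
  have hτ₁ (j : Fin (n - 1)) (hj : (j : ℕ) + 1 < p) : (D.τ j : ℕ) + 1 = p - (j + 1) := by
    have h₁ := D.dvd_τ p (fun i => ((if (i : ℕ) + 1 < p then i + 1 else 0 : ℕ) : ℤ))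
      (by simp; omega) (fun j hj => by
        rw [hne] at hj
        rw [sum_mul_cartanMatrixA (fun i => ((if i < p then i else 0 : ℕ) : ℤ)) (by simp)]
        have := j.2
        rcases Nat.lt_or_ge (j + 2) p with h | h
        · simp only [show (j : ℕ) + 1 < p by omega, show (j : ℕ) < p by omega, h, if_true,
            show (j : ℕ) + 1 < n - 1 by omega]
          exact ⟨0, by push_cast; ring⟩
        rcases Nat.lt_or_ge (j + 1) p with h' | h'
        · simp only [h', show (j : ℕ) < p by omega, h.not_gt, if_true, if_false]
          exact ⟨1, by split_ifs <;> (push_cast; omega)⟩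
        · simp only [h'.not_gt, show ¬ (j : ℕ) < p by omega, h.not_gt, if_false]
          simp) j
    rw [if_pos hj] at h₁
    have h₂ : p ∣ (j + 1) + (if (D.τ j : ℕ) + 1 < p then (D.τ j : ℕ) + 1 else 0) := by
      exact_mod_cast h₁
    split_ifs at h₂
    · have := Nat.eq_of_dvd_of_lt_two_mul (by omega) h₂ (by omega)
      omega
    · have := Nat.le_of_dvd (by omega) h₂
      omega
  -- the last fundamental weight, times `n - p`, for the simple roots after `β`
  have hτ₂ (j : Fin (n - 1)) (hj : p < (j : ℕ) + 1) : (D.τ j : ℕ) + 1 = n + p - (j + 1) := by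
    have h₁ := D.dvd_τ (n - p : ℕ) (fun i => (((i : ℕ) + 1 - p : ℕ) : ℤ))
      (by simp; omega) (fun j hj => by
        rw [hne] at hj
        rw [sum_mul_cartanMatrixA (fun i => ((i - p : ℕ) : ℤ)) (by simp)]
        have := j.2
        split_ifs with h
        · exact ⟨0, by omega⟩
        · exact ⟨1, by omega⟩) j
    have h₂ : n - p ∣ (j + 1 - p) + (D.τ j + 1 - p) := by exact_mod_cast h₁
    have := j.2
    have := (D.τ j).2
    have := Nat.eq_of_dvd_of_lt_two_mul (by omega) h₂ (by omega)
    omega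
  -- the fundamental weight at the node of `β`, times `n`
  have hθ := D.parabolic_smul_root_self
    (u := fun i => (if (i : ℕ) + 1 ≤ p then (i + 1) * (n - p) else p * (n - (i + 1)) : ℤ))
    (θ := fun _ => 1) (fun j hj => by
      rw [hne] at hj
      have := sum_mul_cartanMatrixA (m := n - 1)
        (fun i => if i ≤ p then (i * (n - p) : ℤ) else p * (n - i)) (by simp) j
      push_cast at this
      rw [this]
      have := j.2
      rcases Nat.lt_or_ge (j + 1) p with h' | h'
      · rw [if_pos h'.le, if_pos (show (j : ℕ) ≤ p by omega),
          if_pos (show (j : ℕ) + 1 < n - 1 by omega), if_pos (show (j : ℕ) + 2 ≤ p by omega)]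
        ring
      · have e : ((if (j : ℕ) ≤ p then (j * (n - p) : ℤ) else p * (n - j))) = p * (n - j) := by
          split_ifs with h''
          · rw [show (j : ℕ) = p by omega]
          · rfl
        rw [e, if_neg (show ¬ (j : ℕ) + 1 ≤ p by omega),
          if_neg (show ¬ (j : ℕ) + 2 ≤ p by omega)]
        split_ifs with h''
        · ring
        · rw [show (n : ℤ) = j + 2 by omega]; ring)
    (by
      simp only [show p - 1 + 1 = p by omega, le_refl, if_true]
      have : (0 : ℤ) < (p - 1 : ℕ) + 1 := by positivity
      have : (0 : ℤ) < n - p := by omega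
      positivity) rfl
    (fun i hi => by
      rw [hne] at hi
      have := i.2
      have hk : ((p - 1 : ℕ) : ℤ) + 1 = p := by omega
      simp only [show p - 1 + 1 = p by omega, le_refl, if_true, hk]
      rcases Nat.lt_or_ge (i + 1) p with h' | h'
      · have e := hτ₁ i h'
        have e' : ((D.τ i : ℕ) : ℤ) + 1 = p - (i + 1) := by omega
        rw [if_pos h'.le, if_pos (by omega), e']; ring
      · have e := hτ₂ i (by omega)
        have e' : ((D.τ i : ℕ) : ℤ) + 1 = n + p - (i + 1) := by omega
        rw [if_neg (by omega), if_neg (by omega), e']; ring)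
  have rk := D.rotation_smul_self hθ (fun _ => rfl)
  have rθ := D.rotation_smul_neg_sum hθ
  -- the simple roots and the lowest root, as a sequence of period `n`
  let v : ℤ → M := fun t => if h : t % n = 0 then -∑ i, (1 : ℤ) • D.root i
    else D.root ⟨(t % n).toNat - 1, by
      have := Int.emod_nonneg t (b := n) (by omega)
      have := Int.emod_lt_of_pos t (b := n) (by omega)
      omega⟩
  have hv0 {t : ℤ} (ht : t % n = 0) : v t = -∑ i, (1 : ℤ) • D.root i := dif_pos ht
  have hv {t : ℤ} (i : Fin (n - 1)) (ht : t % n = i + 1) : v t = D.root i := by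
    have h0 : ¬ t % n = 0 := by omega
    simp only [v, dif_neg h0]
    congr 1
    apply Fin.ext
    simp only
    omega
  have hr (t : ℤ) : rotation b β • v t = v (t - p) := by
    have h₁ := Int.emod_nonneg t (b := n) (by omega)
    have h₂ := Int.emod_lt_of_pos t (b := n) (by omega)
    have hsub : (t - p) % n = (t % n - p) % n := by simp
    have hsub' : (t - p) % n = (t % n - p + n) % n := by simp
    by_cases h0 : t % n = 0
    · rw [hv0 h0, rθ]
      refine (hv _ ?_).symm
      have := hσ ⟨p - 1, hk⟩
      simp only at this
      rw [hsub', Int.emod_eq_of_lt (by omega) (by omega)]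
      omega
    obtain ⟨i, hi⟩ : ∃ i : Fin (n - 1), t % n = i + 1 := ⟨⟨(t % n).toNat - 1, by omega⟩, by
      simp only; omega⟩
    rw [hv i hi]
    by_cases hip : (i : ℕ) + 1 = p
    · have hik : i = ⟨p - 1, hk⟩ := Fin.ext (by simp only; omega)
      rw [hik, rk, hv0]
      rw [hsub, hi, show (i : ℤ) + 1 - p = 0 by omega, Int.zero_emod]
    rw [D.rotation_smul ((hne i).mpr hip)]
    refine (hv _ ?_).symm
    have := hσ (D.τ i)
    have := i.2
    rcases Nat.lt_or_ge (i + 1) p with h' | h'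
    · have := hτ₁ i h'
      rw [hsub', Int.emod_eq_of_lt (by omega) (by omega)]
      omega
    · have := hτ₂ i (by omega)
      rw [hsub, Int.emod_eq_of_lt (by omega) (by omega)]
      omega
  have hrm (m : ℕ) (t : ℤ) : rotation b β ^ m • v t = v (t - m * p) := by
    induction m generalizing t with
    | zero => simp
    | succ m ih => rw [pow_succ, mul_smul, hr, ih]; congr 1; push_cast; ring
  have hvp : v p = D.root ⟨p - 1, hk⟩ := hv _ (by
    rw [Int.emod_eq_of_lt (by omega) (by omega)]; simp only; omega)
  have hiff (m : ℕ) : eta b β ∣ m ↔ n ∣ m * p := by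
    constructor
    · intro hm
      have h₁ := D.coord_pow_smul_of_eta_dvd hm
      by_contra hd
      rw [← hvp, hrm] at h₁
      have hmod : ¬ ((p : ℤ) - m * p) % n = p := fun hmod => hd (by
        have h₂ : (n : ℤ) ∣ (p - m * p) - p := Int.dvd_self_sub_of_emod_eq hmod
        have h₃ : (n : ℤ) ∣ m * p := by
          rw [show (m : ℤ) * p = -((p - m * p) - p) by ring]
          exact (dvd_neg).mpr h₂
        exact_mod_cast h₃)
      by_cases h0 : ((p : ℤ) - m * p) % n = 0
      · rw [hv0 h0, map_neg, map_sum, Finset.sum_eq_single (⟨p - 1, hk⟩ : Fin (n - 1))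
          (fun i _ hi => by rw [one_smul, D.coord_root_ne i hi]) (by simp), one_smul,
          D.coord_root_self] at h₁
        norm_num at h₁
      · obtain ⟨i, hi⟩ : ∃ i : Fin (n - 1), ((p : ℤ) - m * p) % n = i + 1 := by
          have h₁ := Int.emod_nonneg ((p : ℤ) - m * p) (b := n) (by omega)
          have h₂ := Int.emod_lt_of_pos ((p : ℤ) - m * p) (b := n) (by omega)
          exact ⟨⟨(((p : ℤ) - m * p) % n).toNat - 1, by omega⟩, by simp only; omega⟩
        rw [hv i hi, D.coord_root_ne i ((hne i).mpr (by omega))] at h₁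
        exact zero_ne_one h₁
    · rintro ⟨c, hc⟩
      apply D.eta_dvd
      intro i
      have hi : v (i + 1) = D.root i := hv i (Int.emod_eq_of_lt (by omega) (by omega))
      have hc' : (m : ℤ) * p = n * c := by exact_mod_cast hc
      rw [← hi, hrm, hi]
      apply hv
      rw [hc', Int.sub_mul_emod_self_left]
      exact Int.emod_eq_of_lt (by omega) (by omega)
  have hg : Nat.gcd p (n - p) = Nat.gcd n p := by
    rw [Nat.gcd_sub_self_right hpn.le, Nat.gcd_comm]
  rw [hg]
  have hpos : 0 < Nat.gcd n p := Nat.gcd_pos_of_pos_right _ hp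
  apply Nat.dvd_antisymm
  · rw [hiff, Nat.div_mul_right_comm (Nat.gcd_dvd_left n p),
      Nat.mul_div_assoc _ (Nat.gcd_dvd_right n p)]
    exact dvd_mul_right _ _
  · have h₁ := (hiff (eta b β)).mp dvd_rfl
    have hcop := Nat.coprime_div_gcd_div_gcd hpos
    apply hcop.dvd_of_dvd_mul_right
    rw [← Nat.mul_div_assoc _ (Nat.gcd_dvd_right n p)]
    exact Nat.div_dvd_div (Nat.gcd_dvd_left n p) h₁

/-! ### The orthogonal type -/

/-- The nodes of the diagram are `0, …, m`.  The nodes before the last one form a chain, and node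
`m` is attached to node `m - 2`. -/
theorem sum_mul_cartanMatrixD {m : ℕ} (Y : ℕ → ℤ) (j : Fin (m + 1)) :
    ∑ i : Fin (m + 1), Y i * CartanMatrix.D (m + 1) i j =
      if (j : ℕ) = m then 2 * Y m - (if 2 ≤ m then Y (m - 2) else 0)
      else 2 * Y j - (if 0 < (j : ℕ) then Y (j - 1) else 0) -
        (if (j : ℕ) + 1 < m then Y (j + 1) else 0) - if (j : ℕ) + 2 = m then Y m else 0 := by
  obtain ⟨j, hj⟩ := j
  by_cases hjm : j = m
  · subst hjm
    rw [if_pos rfl]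
    have h (i : Fin (j + 1)) : Y i * CartanMatrix.D (j + 1) i ⟨j, hj⟩ =
        (if j = i then 2 * Y i else 0) - if j = i + 2 then Y i else 0 := by
      have := i.2
      simp only [CartanMatrix.D, Matrix.of_apply, Fin.ext_iff, or_true, and_true]
      split_ifs <;> omega
    simp only [h, Fin.sum_univ_eq_sum_range
      (fun i => (if j = i then 2 * Y i else 0) - if j = i + 2 then Y i else 0),
      Finset.sum_sub_distrib, Finset.sum_ite_eq, Finset.mem_range, if_pos hj]
    rcases j with _ | _ | j
    · simp
    · simp
    · simp only [Nat.add_right_cancel_iff, Finset.sum_ite_eq, Finset.mem_range,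
        if_pos (show j < j + 1 + 1 + 1 by omega), if_pos (show 2 ≤ j + 1 + 1 by omega)]
      rfl
  · rw [if_neg hjm]
    have h (i : Fin (m + 1)) : Y i * CartanMatrix.D (m + 1) i ⟨j, hj⟩ =
        (if j = i then 2 * Y i else 0) - (if j = i + 1 then Y i else 0) -
          (if j + 1 = i then if j + 1 < m then Y i else 0 else 0) -
            if m = i then if j + 2 = m then Y i else 0 else 0 := by
      have := i.2
      simp only [CartanMatrix.D, Matrix.of_apply, Fin.ext_iff]
      split_ifs <;> omega
    simp only [h, Fin.sum_univ_eq_sum_range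
      (fun i => (if j = i then 2 * Y i else 0) - (if j = i + 1 then Y i else 0) -
        (if j + 1 = i then if j + 1 < m then Y i else 0 else 0) -
          if m = i then if j + 2 = m then Y i else 0 else 0),
      Finset.sum_sub_distrib, Finset.sum_ite_eq, Finset.mem_range, if_pos hj,
      if_pos (Nat.lt_succ_self m), if_pos (show j + 1 < m + 1 by omega)]
    congr 3
    rcases j with _ | j
    · simp
    · simp only [Nat.add_right_cancel_iff, Finset.sum_ite_eq, Finset.mem_range,
        if_pos (show j < m + 1 by omega), if_pos (Nat.succ_pos j)]
      rfl

/-- If the rank is even, then `-w₀` fixes `β`.  If it is odd, then `-w₀` interchanges the last two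
nodes, and `w₀ w₀ᴾ` is a symmetry of order four of the extended Dynkin diagram: it permutes the
lowest root, the first simple root and the last two simple roots cyclically. -/
theorem eta_typeD {m : ℕ} (hn : 1 ≤ m)
    (h : HasType b β (CartanMatrix.D (m + 1)) (Fin.last m)) :
    eta b β = 4 / Nat.gcd 2 (m + 1) := by
  obtain ⟨D⟩ := h.nonempty_numberedOpposition
  have hσinj : Function.Injective D.σ := (show Function.Involutive D.σ from D.σ_σ).injective
  have hτinj : Function.Injective D.τ := (show Function.Involutive D.τ from D.τ_τ).injective
  -- half the sum of the last two simple roots pairs integrally with all coroots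
  have hσ₁ : m - 1 ≤ (D.σ (Fin.last m) : ℕ) := by
    have h₁ := D.dvd_σ 2 (fun i => if m - 1 ≤ (i : ℕ) then 1 else 0) (fun j => by
      have hsum := sum_mul_cartanMatrixD (fun i => if m - 1 ≤ i then 1 else 0) j
      rw [hsum]
      have := j.2
      split_ifs <;> omega) (Fin.last m)
    by_contra! hlt
    rw [if_pos (by simp), if_neg (by omega)] at h₁
    omega
  -- the half-spin weight at the last node, times `4`
  let u : ℕ → ℤ := fun i => if i = m then m + 1 else if i + 1 = m then m - 1 else 2 * (i + 1)
  have hu (j : Fin (m + 1)) : ∑ i : Fin (m + 1), u i * CartanMatrix.D (m + 1) i j =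
      if (j : ℕ) = m then 4 else 0 := by
    rw [sum_mul_cartanMatrixD]
    have := j.2
    simp only [u]
    split_ifs <;> push_cast <;> omega
  have hσ₂ : (4 : ℤ) ∣ m + 1 + u (D.σ (Fin.last m)) := by
    have := D.dvd_σ 4 (fun i => u i) (fun j => by rw [hu]; split_ifs <;> simp) (Fin.last m)
    simpa [u] using this
  rcases Nat.even_or_odd m with heven | hodd
  · -- the rank `m + 1` is odd
    have hm : 2 ≤ m := by obtain ⟨c, rfl⟩ := heven; omega
    have hσlast : (D.σ (Fin.last m) : ℕ) + 1 = m := by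
      by_contra hne
      have := (D.σ (Fin.last m)).2
      have h₁ : (D.σ (Fin.last m) : ℕ) = m := by omega
      simp only [u] at hσ₂
      rw [if_pos h₁] at hσ₂
      obtain ⟨c, rfl⟩ := heven
      omega
    have hσpen (i : Fin (m + 1)) (hi : (i : ℕ) + 1 = m) : D.σ i = Fin.last m := by
      rw [show i = D.σ (Fin.last m) from Fin.ext (by omega), D.σ_σ]
    have hlink (i j : Fin (m + 1)) (h : CartanMatrix.D (m + 1) i j = -1) :
        (i : ℕ) + 1 = j ∨ (j : ℕ) + 1 = i ∨ ((i : ℕ) + 2 = j ∧ (j : ℕ) = m) ∨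
          ((j : ℕ) + 2 = i ∧ (i : ℕ) = m) := by
      simp only [CartanMatrix.D, Matrix.of_apply] at h
      split_ifs at h <;> omega
    have hlast (i : Fin (m + 1)) (h : CartanMatrix.D (m + 1) i (Fin.last m) = -1) :
        (i : ℕ) + 2 = m := by
      simp only [CartanMatrix.D, Matrix.of_apply, Fin.val_last] at h
      split_ifs at h <;> omega
    -- the nodes other than the last two are fixed, by descent along the chain they form
    have hσ (t : ℕ) : ∀ i : Fin (m + 1), (i : ℕ) + 2 ≤ m → m ≤ i + 2 + t → D.σ i = i := by
      induction t with
      | zero =>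
        intro i hi hi'
        have h₁ := D.cartan_σ i ⟨m - 1, by omega⟩
        rw [hσpen ⟨m - 1, by omega⟩ (Nat.sub_add_cancel hn)] at h₁
        have h₂ := hlast (D.σ i) (h₁.trans (by
          simp only [CartanMatrix.D, Matrix.of_apply, Fin.ext_iff]
          split_ifs <;> omega))
        exact Fin.ext (by omega)
      | succ t ih =>
        intro i hi hi'
        rcases Nat.lt_or_ge (i + 2 + t) m with hlt | hge
        swap
        · exact ih i hi hge
        have hi'' : (i : ℕ) + 1 < m + 1 := by omega
        have h₁ := D.cartan_σ i ⟨i + 1, hi''⟩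
        rw [ih ⟨i + 1, hi''⟩ (by simp only; omega) (by simp only; omega)] at h₁
        have h₂ := hlink (D.σ i) ⟨i + 1, hi''⟩ (h₁.trans (by
          simp only [CartanMatrix.D, Matrix.of_apply, Fin.ext_iff, true_and]
          split_ifs <;> omega))
        simp only at h₂
        have h₃ : (D.σ i : ℕ) ≤ i := by
          by_contra! hgt
          have h₄ : (D.σ (D.σ i) : ℕ) = i := congrArg Fin.val (D.σ_σ i)
          rcases Nat.lt_or_ge m (D.σ i + 2) with h₅ | h₅
          · rcases Nat.lt_or_ge (D.σ i) (m : ℕ) with h₆ | h₆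
            · rw [hσpen _ (by omega), Fin.val_last] at h₄
              omega
            · rw [show D.σ i = Fin.last m from Fin.ext (by simp only [Fin.val_last]; omega)] at h₄
              omega
          · rw [ih _ h₅ (by omega)] at h₄
            omega
        exact Fin.ext (by omega)
    replace hσ (i : Fin (m + 1)) (hi : (i : ℕ) + 2 ≤ m) : D.σ i = i := hσ m i hi (by omega)
    have hne (i : Fin (m + 1)) : i ≠ Fin.last m ↔ (i : ℕ) < m := by
      rw [ne_eq, Fin.ext_iff, Fin.val_last]
      omega
    -- the last fundamental weight, times `m + 1`, for the simple roots before `β`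
    have hτ (i : Fin (m + 1)) (hi : (i : ℕ) < m) : (D.τ i : ℕ) + 1 = m - i := by
      have h₁ := D.dvd_τ (m + 1 : ℕ) (fun i => ((if (i : ℕ) < m then i + 1 else 0 : ℕ) : ℤ))
        (by simp) (fun j hj => by
          rw [hne] at hj
          rw [sum_mul_cartanMatrixD (fun i => ((if i < m then i + 1 else 0 : ℕ) : ℤ))]
          by_cases hj' : (j : ℕ) + 1 < m
          · exact ⟨0, by split_ifs <;> omega⟩
          · exact ⟨1, by split_ifs <;> omega⟩) i
      rw [if_pos hi] at h₁
      have h₂ : m + 1 ∣ (i + 1) + (if (D.τ i : ℕ) < m then (D.τ i : ℕ) + 1 else 0) := by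
        exact_mod_cast h₁
      split_ifs at h₂
      · have := Nat.eq_of_dvd_of_lt_two_mul (by omega) h₂ (by omega)
        omega
      · have := Nat.le_of_dvd (by omega) h₂
        omega
    -- the highest root
    let θ : Fin (m + 1) → ℤ := fun i => if (i : ℕ) = 0 ∨ m ≤ i + 1 then 1 else 2
    have hθ := D.parabolic_smul_root_self (u := fun i => u i) (θ := θ)
      (fun j hj => by
        rw [hne] at hj
        rw [hu, if_neg hj.ne])
      (by simp only [u, Fin.val_last, if_true]; omega)
      (by simp [θ])
      (fun i hi => by
        rw [hne] at hi
        have := hτ i hi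
        simp only [u, θ, Fin.val_last, if_true]
        split_ifs <;> omega)
    have rk := D.rotation_smul_self hθ (fun i => by
      rcases Nat.lt_or_ge m (i + 2) with hi | hi
      · have h₁ : m ≤ (D.σ i : ℕ) + 1 := by
          rcases Nat.lt_or_ge (i : ℕ) m with hi' | hi'
          · rw [hσpen i (by omega), Fin.val_last]
            omega
          · rw [show i = Fin.last m from Fin.ext (by simp only [Fin.val_last]; omega)]
            omega
        simp only [θ]
        rw [if_pos (Or.inr h₁), if_pos (Or.inr (by omega))]
      · rw [hσ i hi])
    have rθ := D.rotation_smul_neg_sum hθ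
    have r0 (i : Fin (m + 1)) (hi : (i : ℕ) = 0) :
        rotation b β • D.root i = D.root (Fin.last m) := by
      have := hτ i (by omega)
      rw [D.rotation_smul ((hne i).mpr (by omega)), hσpen _ (by omega)]
    have r (i j : Fin (m + 1)) (hi : 0 < (i : ℕ)) (hij : (i : ℕ) + j + 1 = m) :
        rotation b β • D.root i = D.root j := by
      have := hτ i (by omega)
      rw [D.rotation_smul ((hne i).mpr (by omega)), hσ _ (by omega)]
      congr 1
      exact Fin.ext (by omega)
    have rpen := r (D.σ (Fin.last m)) 0 (by omega) (by simp only [Fin.val_zero]; omega)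
    have rzero := r0 0 rfl
    have h4 : eta b β ∣ 4 := D.eta_dvd fun i => by
      simp only [pow_succ, pow_zero, one_mul, mul_smul]
      by_cases hi : (i : ℕ) = m
      · rw [show i = Fin.last m from Fin.ext hi, rk, rθ, rpen, rzero]
      by_cases hi₁ : (i : ℕ) + 1 = m
      · rw [show i = D.σ (Fin.last m) from Fin.ext (by omega), rpen, rzero, rk, rθ]
      by_cases hi₀ : (i : ℕ) = 0
      · rw [show i = 0 from Fin.ext hi₀, rzero, rk, rθ, rpen]
      have hj : m - 1 - i < m + 1 := by omega
      have h₁ := r i ⟨m - 1 - i, hj⟩ (by omega) (by simp only; omega)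
      have h₂ := r ⟨m - 1 - i, hj⟩ i (by simp only; omega) (by simp only; omega)
      rw [h₁, h₂, h₁, h₂]
    have h2 : ¬ eta b β ∣ 2 := fun h => by
      have h₁ := D.coord_pow_smul_of_eta_dvd h
      rw [pow_two, mul_smul, rk, rθ, D.coord_root_ne _ ((hne _).mpr (by omega))] at h₁
      exact zero_ne_one h₁
    have hg : Nat.gcd 2 (m + 1) = 1 := by
      rw [← Nat.coprime_iff_gcd_eq_one, Nat.coprime_two_left]
      exact heven.add_one
    rw [hg]
    obtain ⟨c, hc, hηc⟩ := (Nat.dvd_prime_pow Nat.prime_two (m := 2)).mp h4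
    interval_cases c
    · exact absurd (hηc ▸ one_dvd 2) h2
    · exact absurd (hηc ▸ dvd_rfl) h2
    · exact hηc
  · -- the rank `m + 1` is even
    have hg : Nat.gcd 2 (m + 1) = 2 := Nat.gcd_eq_left (by obtain ⟨c, rfl⟩ := hodd; omega)
    rw [hg]
    apply D.eta_eq_two
    apply Fin.ext
    by_contra hne
    have := (D.σ (Fin.last m)).2
    simp only [Fin.val_last] at hne
    simp only [u] at hσ₂
    rw [if_neg hne, if_pos (by omega)] at hσ₂
    obtain ⟨c, rfl⟩ := hodd
    omega

end HiddenSymmetry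

theorem mainTheorem11 {J K M N : Type*} [Finite J] [Field K] [CharZero K]
    [AddCommGroup M] [Module K M] [AddCommGroup N] [Module K N]
    (P : RootPairing J K M N) [P.IsRootSystem] [P.IsCrystallographic] [P.IsReduced]
    (b : P.Base) (β : b.support) :
    -- any minuscule or cominuscule `X = G / P` with `G` simple, other than `ℙ¹`
    (P.IsIrreducible → HiddenSymmetry.IsMinuscule b β ∨ HiddenSymmetry.IsCominuscule b β →
      2 ≤ b.support.card →
      Nat.card (HiddenSymmetry.symmetryGroup b β) = 2 * HiddenSymmetry.eta b β ^ 2) ∧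
    -- `𝔾(p, n)`, of type `A_{n-1} / P_p`
    (∀ (p n : ℕ) (hp : 0 < p) (hpn : p < n),
      HiddenSymmetry.HasType b β (CartanMatrix.A (n - 1)) ⟨p - 1, by omega⟩ →
      HiddenSymmetry.eta b β = n / Nat.gcd p (n - p)) ∧
    -- `𝔾_ω(n, 2n)`, of type `C_n / P_n`
    (∀ (n : ℕ) (hn : 1 ≤ n),
      HiddenSymmetry.HasType b β (CartanMatrix.C n) ⟨n - 1, by omega⟩ →
      HiddenSymmetry.eta b β = 2) ∧
    -- `𝔾_Q(n, 2n)`, of type `D_n / P_n`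
    (∀ (n : ℕ) (hn : 2 ≤ n),
      HiddenSymmetry.HasType b β (CartanMatrix.D n) ⟨n - 1, by omega⟩ →
      HiddenSymmetry.eta b β = 4 / Nat.gcd 2 n) ∧
    -- the Cayley plane `𝕆ℙ² = E₆ / P₁`
    (HiddenSymmetry.HasType b β CartanMatrix.E₆ 0 → HiddenSymmetry.eta b β = 3) ∧
    -- the Freudenthal variety `E₇ / P₇`
    (HiddenSymmetry.HasType b β CartanMatrix.E₇ 6 → HiddenSymmetry.eta b β = 2) := by
  refine ⟨fun hP _ hcard => HiddenSymmetry.card_symmetryGroup hP hcard,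
    fun _ _ hp hpn h => HiddenSymmetry.eta_typeA hp hpn rfl h, fun n hn h => ?_, fun n hn h => ?_,
    HiddenSymmetry.eta_typeE₆, HiddenSymmetry.eta_typeE₇⟩
  · obtain ⟨m, rfl⟩ := Nat.exists_eq_add_of_le' hn
    exact HiddenSymmetry.eta_typeC h
  · obtain ⟨m, rfl⟩ := Nat.exists_eq_add_of_le' (Nat.le_of_succ_le hn)
    exact HiddenSymmetry.eta_typeD (Nat.le_of_succ_le_succ hn) h
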